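/- Conventions. Time is counted in operations in $\mathbb F_p$. An algorithm is a computable family of straight-line programs: from the integer parameters it produces a straight-line program over $\mathbb F_p$, whose instructions (additions, subtractions, multiplications, and the loading of a constant, each counted as one operation) are carried out on the coefficients of the input polynomials and yield the coefficients of the output. Let $\mathsf M=\mathsf M_p:\mathbb N\to\mathbb N$ be a multiplication function: some such algorithm, with parameters $p$ and $n$, multiplies any two polynomials of $\mathbb F_p[X]$ of degree less than $n$ in at most $\mathsf M(n)$ operations, for all primes $p$ and all $n\ge 1$; and $\mathsf M(m)/m\le \mathsf M(n)/n$ for $1\le m\le n$ and $\mathsf M(mn)\le m^2\,\mathsf M(n)$ for $m,n\ge1$. The tower. Let $p$ be a prime, let $Q_0\in\mathbb F_p[X_0]$ be irreducible of degree $d$, let $\mathbb U_0=\mathbb F_p[X_0]/(Q_0)$ and $x_0=X_0\bmod Q_0$, and assume $\mathrm{Tr}_{\mathbb U_0/\mathbb F_p}(x_0)\neq 0$. Put $G_0=X_0$; $G_1=X_1$ if $p=2$ and $d$ is odd; and $G_i=X_i^{2p-1}$ in all other cases. For $i\ge 0$ let $$\mathbb U_i=\mathbb F_p[X_0,\dots,X_i]\big/\big(Q_0(X_0),\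 X_1^p-X_1-G_0,\ \dots,\ X_i^p-X_i-G_{i-1}\big),$$ let $x_i$ be the residue class of $X_i$ in $\mathbb U_i$, and let $Q_i\in\mathbb F_p[X]$ be the minimal polynomial of $x_i$ over $\mathbb F_p$ (up to a constant factor, this is the given $Q_0$ for $i=0$). Theorem. There is an absolute constant $C$ such that for every multiplication function $\mathsf M$ there is one algorithm that, for all $p$, $d$, $Q_0$ as above and all $i\ge 0$, given $p,d,i$ and the coefficients of $Q_i$, computes the coefficients of $Q_{i+1}$ in at most $$C\,\big(p^{i+2}d\,\log_p(p^id)+\mathsf M(p^{i+2}d)\,\log p\big)$$ operations in $\mathbb F_p$. Moreover, $Q_{i+1}$ is given as follows. If $i=0$, or if $p=2$, $d$ is odd and $i=1$, then $Q_{i+1}=Q_i(Y^p-Y)$. Otherwise, let $\Phi\in\mathbb F_p[X]$ be the reduction modulo $p$ of the $(2p-1)$th cyclotomic polynomial, $A=\mathbb F_p[X]/(\Phi)$, $x=X\bmod\Phi$, and $Q_i^\star=\prod_{j=0}^{2p-2}Q_i(x^jY)\in A[Y]$; then there is $q_i^\star\in\mathbb F_p[Y]$ with $Q_i^\star=q_i^\star(Y^{2p-1})$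 and $Q_{i+1}=q_i^\star(Y^p-Y)$. -/

import Mathlib

open Polynomial

/-! ### Straight-line programs over `𝔽_p` and their operation count -/

/-- One operation in the ground field: loading a constant, or an addition, subtraction or
multiplication of two values that are already available (referred to by their positions). -/
inductive Instr : Type
  | const (c : ℕ) : Instr
  | add (a b : ℕ) : Instr
  | sub (a b : ℕ) : Instr
  | mul (a b : ℕ) : Instr

namespace Instr

/-- Instructions as a sum of data types; it only serves to speak of computable families of
programs. -/
def equivSum : Instr ≃ (ℕ ⊕ (ℕ × ℕ)) ⊕ ((ℕ × ℕ) ⊕ (ℕ × ℕ)) where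
  toFun
    | const c => Sum.inl (Sum.inl c)
    | add a b => Sum.inl (Sum.inr (a, b))
    | sub a b => Sum.inr (Sum.inl (a, b))
    | mul a b => Sum.inr (Sum.inr (a, b))
  invFun
    | Sum.inl (Sum.inl c) => const c
    | Sum.inl (Sum.inr (a, b)) => add a b
    | Sum.inr (Sum.inl (a, b)) => sub a b
    | Sum.inr (Sum.inr (a, b)) => mul a b
  left_inv I := by cases I <;> rfl
  right_inv s := by rcases s with (_ | ⟨_, _⟩) | (⟨_, _⟩ | ⟨_, _⟩) <;> rfl

instance : Primcodable Instr := Primcodable.ofEquiv _ equivSum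

/-- The value of an instruction, given the list `w` of the values available so far (positions
beyond the end of `w` hold `0`). -/
def eval {F : Type*} [CommRing F] (w : List F) : Instr → F
  | const c => (c : F)
  | add a b => w.getD a 0 + w.getD b 0
  | sub a b => w.getD a 0 - w.getD b 0
  | mul a b => w.getD a 0 * w.getD b 0

end Instr

/-- A straight-line program: the list of its instructions, followed by the list of the positions
of its outputs. -/
abbrev SLProgram : Type := List Instr × List ℕ

namespace SLProgram

/-- The number of operations, loading of constants included. -/
def cost (P : SLProgram) : ℕ := P.1.length

/-- All values of the run: the inputs, followed by the results of the instructions in order. -/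
def run {F : Type*} [CommRing F] (P : SLProgram) (input : List F) : List F :=
  P.1.foldl (fun w I => w ++ [I.eval w]) input

/-- The outputs of the program on the given inputs. -/
def output {F : Type*} [CommRing F] (P : SLProgram) (input : List F) : List F :=
  P.2.map fun k => (P.run input).getD k 0

end SLProgram

/-- The coefficients of `1, X, …, X ^ (n - 1)` in `f`. -/
def coeffsBelow {R : Type*} [Semiring R] (f : R[X]) (n : ℕ) : List R :=
  (List.range n).map f.coeff

/-- The list of all coefficients of `f`, from the constant to the leading one. -/
def allCoeffs {R : Type*} [Semiring R] (f : R[X]) : List R :=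
  coeffsBelow f (f.natDegree + 1)

/-- `mulAlg` is an algorithm that multiplies polynomials of degree less than `n` over `𝔽_p` in at
most `M p n` operations in `𝔽_p`: given `p` and `n` it produces the straight-line program that is
carried out on the coefficients of the two factors. -/
def IsMultiplicationAlgorithm (mulAlg : ℕ × ℕ → SLProgram) (M : ℕ → ℕ → ℕ) : Prop :=
  Computable mulAlg ∧
    ∀ p n : ℕ, p.Prime → 0 < n →
      (mulAlg (p, n)).cost ≤ M p n ∧
        ∀ f g : (ZMod p)[X], f.degree < n → g.degree < n →
          (mulAlg (p, n)).output (coeffsBelow f n ++ coeffsBelow g n) =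
            coeffsBelow (f * g) (2 * n - 1)

/-- The usual growth conditions on a multiplication time: `M n / n` does not decrease, that is
`M m / m ≤ M n / n` for `m ≤ n`, and `M (m n) ≤ m² M n`. -/
def IsRegularTime (M : ℕ → ℕ) : Prop :=
  (∀ m n : ℕ, 0 < m → m ≤ n → M m * n ≤ M n * m) ∧
    ∀ m n : ℕ, 0 < m → 0 < n → M (m * n) ≤ m ^ 2 * M n

/-! ### The primitive Artin-Schreier tower -/

/-- The steps `i` at which `γ_i = x_i` (at all others, `γ_i = x_i ^ (2 p - 1)`). -/
def IsLinearStep (p d i : ℕ) : Prop := i = 0 ∨ (p = 2 ∧ Odd d ∧ i = 1)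

open Classical in
/-- The exponent `e` with `G_i = X_i ^ e`. -/
noncomputable def stepExponent (p d i : ℕ) : ℕ := if IsLinearStep p d i then 1 else 2 * p - 1

/-- The ideal `K_i` of `𝔽_p[X_0, …, X_i]` generated by `Q_0(X_0)` and by the polynomials
`X_{j+1} ^ p - X_{j+1} - G_j(X_j)` for `j < i`. -/
noncomputable def towerIdeal (p : ℕ) (Q₀ : (ZMod p)[X]) (i : ℕ) :
    Ideal (MvPolynomial (Fin (i + 1)) (ZMod p)) :=
  Ideal.span
    (insert (Polynomial.aeval (MvPolynomial.X 0 : MvPolynomial (Fin (i + 1)) (ZMod p)) Q₀)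
      (Set.range fun j : Fin i =>
        (MvPolynomial.X j.succ ^ p - MvPolynomial.X j.succ
          - MvPolynomial.X j.castSucc ^ stepExponent p Q₀.natDegree j :
            MvPolynomial (Fin (i + 1)) (ZMod p))))

/-- The `i`-th level `𝕌_i = 𝔽_p[X_0, …, X_i] / K_i` of the tower. -/
abbrev TowerLevel (p : ℕ) (Q₀ : (ZMod p)[X]) (i : ℕ) : Type :=
  MvPolynomial (Fin (i + 1)) (ZMod p) ⧸ towerIdeal p Q₀ i

/-- The residue class `x_i` of `X_i` in `𝕌_i`. -/
noncomputable def towerGen (p : ℕ) (Q₀ : (ZMod p)[X]) (i : ℕ) : TowerLevel p Q₀ i :=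
  Ideal.Quotient.mk (towerIdeal p Q₀ i) (MvPolynomial.X (Fin.last i))

/-- The minimal polynomial `Q_i` of `x_i` over `𝔽_p`. -/
noncomputable def towerMinpoly (p : ℕ) (Q₀ : (ZMod p)[X]) (i : ℕ) : (ZMod p)[X] :=
  minpoly (ZMod p) (towerGen p Q₀ i)

/-! ### The polynomial `Q^⋆` -/

/-- The ring `A = 𝔽_p[X] / Φ`, where `Φ` is the reduction modulo `p` of the `(2 p - 1)`-th
cyclotomic polynomial. -/
abbrev CycloRing (p : ℕ) : Type := AdjoinRoot (cyclotomic (2 * p - 1) (ZMod p))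

/-- The polynomial `Q^⋆ = ∏_{j = 0}^{2 p - 2} Q(x ^ j Y)` of `A[Y]`, where `x` is the residue class
of `X` in `A`. -/
noncomputable def starPoly (p : ℕ) (Q : (ZMod p)[X]) : (CycloRing p)[X] :=
  ∏ j ∈ Finset.range (2 * p - 1),
    (Q.map (algebraMap (ZMod p) (CycloRing p))).comp
      (C (AdjoinRoot.root (cyclotomic (2 * p - 1) (ZMod p)) ^ j) * X)

/-! The tower is studied in an algebraic closure of `𝔽_p` through the Frobenius `φ`: the degree of
`x` is its period under `φ`, and its trace is the sum over its orbit. Let `γ` have period `n` and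
trace `T ≠ 0`, and let `x ^ p - x = γ`. Then `φ ^ (n s) x = x + s T`, so `x` has period `p n`
(`minimalPeriod_frobenius_artinSchreier`). From `(x + c) ^ (2 p - 1) = (x + c) + γ + γ (x + c) ^ (p
- 1)` the relative trace of `x ^ (2 p - 1)` is `∑ c - γ`, summed over `c` in `𝔽_p`. Hence `x ^ (2 p
- 1)` again has nonzero trace, and period `p n`, if `n` is even or `p` is odd; for `p = 2` and `n`
odd, `x` itself has nonzero trace. By induction (`IsTowerSeq.orbit`) all degrees are as large as
possible, and comparing degrees gives `Q_{i+1} = q (Y ^ p - Y)` with `q` the minimal polynomial of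
`γ_i`.

At a step with `γ_i = x_i ^ e`, `e = 2 p - 1`, one has `∏_j (ζ ^ j Y - b) = Y ^ e - b ^ e` for each
conjugate `b` of `x_i`. As `x_i` and `x_i ^ e` have equally many conjugates, the product of the
twists of `Q_i` is `q (Y ^ e)` (`twistProd_minpoly`). An identity over `A` may be checked at the
primitive `e`-th roots of unity, because `Φ` is separable modulo `p`.

The algorithm works modulo `x ^ e - 1` instead of `Φ`, so that a twist only rotates the rows of
coefficients. Repeated doubling gives the product of all twists with `O(log p)` multiplications,
each reduced to one variable by Kronecker substitution. Multiplying by `∏_l (1 - x ^ (e / l))` over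
the primes `l ∣ e` kills the contribution of the non-primitive roots; as this factor has constant
term `1` modulo `x ^ e - 1`, the coefficients of `q` are then the constant terms of the rows
(`foldl_extractSteps`).

Finally `q (Y ^ p - Y)` is computed in place from `q (Y ^ p)`, one base-`p` digit of the exponents
at a time, by `(Y ^ p - Y) ^ (p ^ k) = Y ^ (p ^ (k + 1)) - Y ^ (p ^ k)` (`levelsMap_X_pow`). Each of
the about `log_p n` levels, `n = p ^ i d`, makes `p - 1` passes over `p n + 1` coefficients, which
yields the first term of the bound; the multiplications yield the second. -/

/-! ### Building straight-line programs -/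

namespace Instr

/-- Change the positions an instruction refers to. -/
def mapPos (f : ℕ → ℕ) : Instr → Instr
  | const c => const c
  | add a b => add (f a) (f b)
  | sub a b => sub (f a) (f b)
  | mul a b => mul (f a) (f b)

theorem eval_mapPos {F : Type*} [CommRing F] {w w' : List F} {f : ℕ → ℕ}
    (h : ∀ k, w'.getD (f k) 0 = w.getD k 0) (I : Instr) : (I.mapPos f).eval w' = I.eval w := by
  cases I <;> simp only [mapPos, eval, h]

end Instr

theorem List.getD_append_offset {α : Type*} (w x : List α) (k : ℕ) (a : α) :
    (w ++ x).getD (w.length + k) a = x.getD k a := by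
  rw [List.getD_append_right _ _ _ _ (Nat.le_add_right _ _), Nat.add_sub_cancel_left]

namespace SLProgram

variable {F : Type*} [CommRing F]

/-- The values after the execution of a list of instructions. -/
def exec (l : List Instr) (w : List F) : List F :=
  l.foldl (fun w I => w ++ [I.eval w]) w

theorem run_eq_exec (P : SLProgram) (x : List F) : P.run x = exec P.1 x := rfl

theorem exec_append (l₁ l₂ : List Instr) (w : List F) :
    exec (l₁ ++ l₂) w = exec l₂ (exec l₁ w) := List.foldl_append

theorem length_exec (l : List Instr) (w : List F) : (exec l w).length = w.length + l.length := by
  induction l generalizing w with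
  | nil => rfl
  | cons I l ih =>
    change (exec l (w ++ [I.eval w])).length = _
    rw [ih]; simp; omega

theorem exec_shift (l : List Instr) (w x : List F) :
    exec (l.map (Instr.mapPos (w.length + ·))) (w ++ x) = w ++ exec l x := by
  induction l generalizing x with
  | nil => rfl
  | cons I l ih =>
    change exec (l.map _) ((w ++ x) ++ [(I.mapPos (w.length + ·)).eval (w ++ x)]) =
      w ++ exec l (x ++ [I.eval x])
    rw [Instr.eval_mapPos (w := x) fun k => List.getD_append_offset w x k 0, List.append_assoc, ih]

/-- Instructions none of which reads the result of another one can be evaluated independently. -/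
theorem exec_eq_append_map (l : List Instr) (w : List F) (g : Instr → F)
    (h : ∀ I ∈ l, ∀ y : List F, y.length < l.length → I.eval (w ++ y) = g I) :
    exec l w = w ++ l.map g := by
  induction l using List.reverseRecOn with
  | nil => simp [exec]
  | append_singleton l I ih =>
    rw [exec_append, ih fun J hJ y hy => h J (by simp [hJ]) y (by simp; omega)]
    change (w ++ l.map g) ++ [I.eval (w ++ l.map g)] = _
    rw [h I (by simp) _ (by simp)]
    simp

/-- First `P`, with `m` inputs, then `Q` on the outputs of `P`. -/
def comp (m : ℕ) (P Q : SLProgram) : SLProgram :=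
  -- The outputs of `P` are copied to consecutive positions by adding `0`, read from a position that
  -- stays empty during the copying. An output position out of range must be replaced by the
  -- constant `0`, since the copies could fill it.
  (P.1 ++ P.2.map (fun k => if k < m + P.1.length then
        Instr.add k (m + P.1.length + P.2.length) else Instr.const 0) ++
      Q.1.map (Instr.mapPos (m + P.1.length + ·)),
    Q.2.map (m + P.1.length + ·))

theorem cost_comp (m : ℕ) (P Q : SLProgram) :
    (comp m P Q).cost = P.cost + P.2.length + Q.cost := by
  simp [comp, cost, add_assoc]

theorem length_output (P : SLProgram) (x : List F) : (P.output x).length = P.2.length := by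
  simp [output]

theorem output_comp {m : ℕ} (P Q : SLProgram) {x : List F} (hx : x.length = m) :
    (comp m P Q).output x = Q.output (P.output x) := by
  have hlen : (P.run x).length = m + P.1.length := by rw [run_eq_exec, length_exec, hx]
  have hcopy : exec (P.2.map (fun k => if k < m + P.1.length then
      Instr.add k (m + P.1.length + P.2.length) else Instr.const 0)) (P.run x) =
      P.run x ++ P.output x := by
    rw [exec_eq_append_map _ _ (fun I => I.eval (P.run x))]
    · congr 1
      simp only [List.map_map, output]
      refine List.map_congr_left fun k _ => ?_
      simp only [Function.comp]
      split_ifs with hk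
      · simp only [Instr.eval]
        rw [List.getD_eq_default (P.run x) 0 (n := m + P.1.length + P.2.length) (by omega),
          add_zero]
      · rw [List.getD_eq_default _ _ (by omega)]
        simp [Instr.eval]
    · intro I hI y hy
      obtain ⟨k, hk, rfl⟩ := List.mem_map.1 hI
      simp only [List.length_map] at hy
      split_ifs with hk'
      · simp only [Instr.eval]
        rw [List.getD_append _ _ _ k (by omega),
          List.getD_eq_default (P.run x ++ y) _ (by rw [List.length_append]; omega),
          List.getD_eq_default (P.run x) _ (n := m + P.1.length + P.2.length) (by omega)]
      · simp [Instr.eval]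
  have hrun : (comp m P Q).run x = P.run x ++ Q.run (P.output x) := by
    rw [run_eq_exec, comp, exec_append, exec_append, ← run_eq_exec P, hcopy, ← hlen, exec_shift]
    rfl
  rw [output, hrun, output]
  simp only [comp, List.map_map, ← hlen]
  exact List.map_congr_left fun k _ => List.getD_append_offset _ _ _ _

/-- The program that returns its `m` inputs. -/
def idProg (m : ℕ) : SLProgram := ([], List.range m)

theorem getD_map_range {α : Type*} (f : ℕ → α) (n k : ℕ) (a : α) :
    ((List.range n).map f).getD k a = if k < n then f k else a := by
  split_ifs with h
  · simp [List.getD_eq_getElem?_getD, h]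
  · exact List.getD_eq_default _ _ (by simpa using h)

theorem map_getD_range {α : Type*} (x : List α) (a : α) :
    (List.range x.length).map (fun k => x.getD k a) = x := by
  refine List.ext_getElem (by simp) fun k h₁ h₂ => ?_
  simp [List.getD_eq_getElem?_getD, h₂]

theorem output_select (l : List ℕ) (x : List F) :
    output ([], l) x = l.map fun k => x.getD k 0 := rfl

theorem output_idProg {m : ℕ} {x : List F} (hx : x.length = m) : (idProg m).output x = x := by
  subst hx
  exact map_getD_range x 0

/-- The programs of a list, one after the other, with `m` inputs for the first one. -/
def seq (m : ℕ) (l : List SLProgram) : SLProgram := l.foldl (comp m) (idProg m)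

theorem output_seq {m : ℕ} (l : List SLProgram) {x : List F} (hx : x.length = m) :
    (seq m l).output x = l.foldl (fun y P => P.output y) x := by
  induction l using List.reverseRecOn with
  | nil => exact output_idProg hx
  | append_singleton l P ih =>
    rw [seq, List.foldl_append, List.foldl_append, ← ih]
    exact output_comp _ _ hx

theorem cost_seq_le (m : ℕ) (l : List SLProgram) :
    (seq m l).cost ≤ m + (l.map fun P => P.cost + P.2.length).sum := by
  -- The copying of the last outputs is charged as well, since the next composition will need it.
  suffices h : (seq m l).cost + (seq m l).2.length ≤
      m + (l.map fun P => P.cost + P.2.length).sum by omega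
  induction l using List.reverseRecOn with
  | nil => simp [seq, idProg, cost]
  | append_singleton l P ih =>
    have h : seq m (l ++ [P]) = comp m (seq m l) P := by simp [seq, List.foldl_append]
    have h2 : (comp m (seq m l) P).2.length = P.2.length := by simp [comp]
    rw [h, cost_comp, h2, List.map_append, List.sum_append]
    simp only [List.map_cons, List.map_nil, List.sum_cons, List.sum_nil]
    omega

/-- Instructions that are carried out independently on `m` inputs; positions that are not inputs
hold `0`. -/
def parLayer (m : ℕ) (l : List Instr) : SLProgram :=
  -- Position `m + l.length` is still empty when the last instruction is evaluated.
  (l.map (Instr.mapPos fun k => if k < m then k else m + l.length),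
    (List.range l.length).map (m + ·))

theorem cost_parLayer (m : ℕ) (l : List Instr) : (parLayer m l).cost = l.length := by
  simp [parLayer, cost]

theorem length_parLayer (m : ℕ) (l : List Instr) : (parLayer m l).2.length = l.length := by
  simp [parLayer]

theorem output_parLayer {m : ℕ} (l : List Instr) {x : List F} (hx : x.length = m) :
    (parLayer m l).output x = l.map (Instr.eval x) := by
  have h : (parLayer m l).run x = x ++ l.map (Instr.eval x) := by
    have key : ∀ y : List F, y.length < l.length → ∀ k,
        (x ++ y).getD (if k < m then k else m + l.length) 0 = x.getD k 0 := by
      intro y hy k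
      split_ifs with hk
      · rw [List.getD_append _ _ _ k (by omega)]
      · rw [List.getD_eq_default (x ++ y) _ (by rw [List.length_append]; omega),
          List.getD_eq_default x _ (n := k) (by omega)]
    rcases Nat.eq_zero_or_pos l.length with h0 | h0
    · rw [List.length_eq_zero_iff] at h0
      subst h0
      simp [parLayer, run]
    rw [run_eq_exec, parLayer, exec_eq_append_map _ _ (fun I => I.eval x), List.map_map]
    · congr 1
      refine List.map_congr_left fun I _ => Instr.eval_mapPos (fun k => ?_) I
      simpa using key [] h0 k
    · intro I hI y hy
      obtain ⟨J, hJ, rfl⟩ := List.mem_map.1 hI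
      rw [List.length_map] at hy
      rw [Instr.eval_mapPos (key y hy)]
      exact (Instr.eval_mapPos (fun k => by simpa using key [] h0 k) J).symm
  rw [output, h]
  simp only [parLayer, List.map_map]
  refine List.ext_getElem (by simp) fun k h₁ h₂ => ?_
  have := List.getD_append_offset x (l.map (Instr.eval x)) k 0
  rw [hx] at this
  simp only [List.getElem_map, List.getElem_range, Function.comp, this]
  simp only [List.length_map] at h₂
  simp [List.getD_eq_getElem?_getD, h₂]

/-- Keep the first `r` inputs and apply `P` to the other ones. -/
def keep (r : ℕ) (P : SLProgram) : SLProgram :=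
  (P.1.map (Instr.mapPos (r + ·)), List.range r ++ P.2.map (r + ·))

theorem cost_keep (r : ℕ) (P : SLProgram) : (keep r P).cost = P.cost := by simp [keep, cost]

theorem length_keep (r : ℕ) (P : SLProgram) : (keep r P).2.length = r + P.2.length := by
  simp [keep]

theorem output_keep {r : ℕ} (P : SLProgram) {w : List F} (hw : w.length = r) (x : List F) :
    (keep r P).output (w ++ x) = w ++ P.output x := by
  subst hw
  rw [output, run_eq_exec, keep, exec_shift, List.map_append, List.map_map, output, run_eq_exec]
  congr 1
  · conv_rhs => rw [← map_getD_range w 0]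
    refine List.map_congr_left fun k hk => List.getD_append _ _ _ _ (List.mem_range.1 hk)
  · exact List.map_congr_left fun k _ => List.getD_append_offset _ _ _ _

end SLProgram

/-! ### Primitive recursive families of programs -/

attribute [fun_prop] Primrec Primrec.id Primrec.const Primrec.comp Primrec.fst Primrec.snd
  Primrec.pair

section

variable {α β σ : Type*} [Primcodable α] [Primcodable β] [Primcodable σ] {f g : α → ℕ}

@[fun_prop] theorem Primrec.fun_add (hf : Primrec f) (hg : Primrec g) :
    Primrec fun a => f a + g a := Primrec.nat_add.comp hf hg

@[fun_prop] theorem Primrec.fun_sub (hf : Primrec f) (hg : Primrec g) :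
    Primrec fun a => f a - g a := Primrec.nat_sub.comp hf hg

@[fun_prop] theorem Primrec.fun_mul (hf : Primrec f) (hg : Primrec g) :
    Primrec fun a => f a * g a := Primrec.nat_mul.comp hf hg

@[fun_prop] theorem Primrec.fun_div (hf : Primrec f) (hg : Primrec g) :
    Primrec fun a => f a / g a := Primrec.nat_div.comp hf hg

@[fun_prop] theorem Primrec.fun_mod (hf : Primrec f) (hg : Primrec g) :
    Primrec fun a => f a % g a := Primrec.nat_mod.comp hf hg

@[fun_prop] theorem Primrec.fun_min (hf : Primrec f) (hg : Primrec g) :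
    Primrec fun a => min (f a) (g a) := Primrec.nat_min.comp hf hg

@[fun_prop] theorem Primrec.fun_pow (hf : Primrec f) (hg : Primrec g) :
    Primrec fun a => f a ^ g a :=
  (Primrec₂.unpaired'.1 Nat.Primrec.pow).comp hf hg

@[fun_prop] theorem Primrec.fun_ite {c : α → Prop} [DecidablePred c] {f g : α → σ}
    (hc : Primrec fun a => decide (c a)) (hf : Primrec f) (hg : Primrec g) :
    Primrec fun a => if c a then f a else g a :=
  Primrec.ite (primrecPred_iff_primrec_decide.2 hc) hf hg

@[fun_prop] theorem Primrec.fun_decide_le (hf : Primrec f) (hg : Primrec g) :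
    Primrec fun a => decide (f a ≤ g a) := (PrimrecRel.comp Primrec.nat_le hf hg).decide

@[fun_prop] theorem Primrec.fun_decide_lt (hf : Primrec f) (hg : Primrec g) :
    Primrec fun a => decide (f a < g a) := (PrimrecRel.comp Primrec.nat_lt hf hg).decide

@[fun_prop] theorem Primrec.fun_decide_eq (hf : Primrec f) (hg : Primrec g) :
    Primrec fun a => decide (f a = g a) := (PrimrecRel.comp Primrec.eq hf hg).decide

@[fun_prop] theorem Primrec.fun_decide_and {c d : α → Prop} [DecidablePred c] [DecidablePred d]
    (hc : Primrec fun a => decide (c a)) (hd : Primrec fun a => decide (d a)) :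
    Primrec fun a => decide (c a ∧ d a) :=
  ((primrecPred_iff_primrec_decide.2 hc).and (primrecPred_iff_primrec_decide.2 hd)).decide

@[fun_prop] theorem Primrec.fun_decide_or {c d : α → Prop} [DecidablePred c] [DecidablePred d]
    (hc : Primrec fun a => decide (c a)) (hd : Primrec fun a => decide (d a)) :
    Primrec fun a => decide (c a ∨ d a) :=
  ((primrecPred_iff_primrec_decide.2 hc).or (primrecPred_iff_primrec_decide.2 hd)).decide

@[fun_prop] theorem Primrec.fun_range (hf : Primrec f) : Primrec fun a => List.range (f a) :=
  Primrec.list_range.comp hf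

@[fun_prop] theorem Primrec.fun_length {l : α → List β} (hl : Primrec l) :
    Primrec fun a => (l a).length := Primrec.list_length.comp hl

@[fun_prop] theorem Primrec.fun_append {l l' : α → List β} (hl : Primrec l) (hl' : Primrec l') :
    Primrec fun a => l a ++ l' a := Primrec.list_append.comp hl hl'

@[fun_prop] theorem Primrec.fun_cons {b : α → β} {l : α → List β} (hb : Primrec b)
    (hl : Primrec l) : Primrec fun a => b a :: l a := Primrec.list_cons.comp hb hl

@[fun_prop] theorem Primrec.fun_map {l : α → List β} {g : α → β → σ} (hl : Primrec l)
    (hg : Primrec fun q : α × β => g q.1 q.2) : Primrec fun a => (l a).map (g a) :=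
  Primrec.list_map hl hg

@[fun_prop] theorem Primrec.fun_flatMap {l : α → List β} {g : α → β → List σ} (hl : Primrec l)
    (hg : Primrec fun q : α × β => g q.1 q.2) : Primrec fun a => (l a).flatMap (g a) :=
  Primrec.list_flatMap hl hg

@[fun_prop] theorem Primrec.fun_foldl {l : α → List β} {s : α → σ} {g : α → σ → β → σ}
    (hl : Primrec l) (hs : Primrec s) (hg : Primrec fun q : α × σ × β => g q.1 q.2.1 q.2.2) :
    Primrec fun a => (l a).foldl (g a) (s a) :=
  Primrec.list_foldl hl hs (h := fun a q => g a q.1 q.2) hg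

end

namespace Instr

variable {α : Type*} [Primcodable α] {f g : α → ℕ}

@[fun_prop] theorem primrec_const (hf : Primrec f) : Primrec fun a => const (f a) :=
  (Primrec.of_equiv_symm (e := equivSum)).comp (Primrec.sumInl.comp (Primrec.sumInl.comp hf))

@[fun_prop] theorem primrec_add (hf : Primrec f) (hg : Primrec g) :
    Primrec fun a => add (f a) (g a) :=
  (Primrec.of_equiv_symm (e := equivSum)).comp
    (Primrec.sumInl.comp (Primrec.sumInr.comp (hf.pair hg)))

@[fun_prop] theorem primrec_sub (hf : Primrec f) (hg : Primrec g) :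
    Primrec fun a => sub (f a) (g a) :=
  (Primrec.of_equiv_symm (e := equivSum)).comp
    (Primrec.sumInr.comp (Primrec.sumInl.comp (hf.pair hg)))

@[fun_prop] theorem primrec_mul (hf : Primrec f) (hg : Primrec g) :
    Primrec fun a => mul (f a) (g a) :=
  (Primrec.of_equiv_symm (e := equivSum)).comp
    (Primrec.sumInr.comp (Primrec.sumInr.comp (hf.pair hg)))

@[fun_prop] theorem primrec_mapPos {I : α → Instr} {h : α → ℕ → ℕ} (hI : Primrec I)
    (hh : Primrec fun q : α × ℕ => h q.1 q.2) : Primrec fun a => (I a).mapPos (h a) := by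
  have hs : Primrec fun a => equivSum (I a) := (Primrec.of_equiv (e := equivSum)).comp hI
  have hh' : ∀ {β : Type _} [Primcodable β] {u : β → α} {v : β → ℕ}, Primrec u → Primrec v →
      Primrec fun b => h (u b) (v b) := fun hu hv => hh.comp (hu.pair hv)
  refine Primrec.of_eq (f := fun a => Sum.casesOn (equivSum (I a))
    (fun s => Sum.casesOn s (fun c => const c) (fun q => add (h a q.1) (h a q.2)))
    (fun s => Sum.casesOn s (fun q => sub (h a q.1) (h a q.2))
      (fun q => mul (h a q.1) (h a q.2)))) ?_ ?_
  · refine Primrec.sumCasesOn hs ?_ ?_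
    · refine Primrec.sumCasesOn Primrec.snd ?_ ?_
      · exact primrec_const Primrec.snd
      · exact primrec_add (hh' (by fun_prop) (by fun_prop)) (hh' (by fun_prop) (by fun_prop))
    · refine Primrec.sumCasesOn Primrec.snd ?_ ?_
      · exact primrec_sub (hh' (by fun_prop) (by fun_prop)) (hh' (by fun_prop) (by fun_prop))
      · exact primrec_mul (hh' (by fun_prop) (by fun_prop)) (hh' (by fun_prop) (by fun_prop))
  · intro a
    cases I a <;> rfl

end Instr

namespace SLProgram

variable {α : Type*} [Primcodable α]

@[fun_prop] theorem primrec_comp {m : α → ℕ} {P Q : α → SLProgram} (hm : Primrec m)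
    (hP : Primrec P) (hQ : Primrec Q) : Primrec fun a => comp (m a) (P a) (Q a) := by
  unfold comp
  fun_prop

@[fun_prop] theorem primrec_seq {m : α → ℕ} {l : α → List SLProgram} (hm : Primrec m)
    (hl : Primrec l) : Primrec fun a => seq (m a) (l a) := by
  unfold seq idProg
  fun_prop

@[fun_prop] theorem primrec_parLayer {m : α → ℕ} {l : α → List Instr} (hm : Primrec m)
    (hl : Primrec l) : Primrec fun a => parLayer (m a) (l a) := by
  unfold parLayer
  fun_prop

@[fun_prop] theorem primrec_keep {m : α → ℕ} {P : α → SLProgram} (hm : Primrec m)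
    (hP : Primrec P) : Primrec fun a => keep (m a) (P a) := by
  unfold keep
  fun_prop

end SLProgram

@[fun_prop] theorem Primrec.fun_log {α : Type*} [Primcodable α] {f g : α → ℕ} (hf : Primrec f)
    (hg : Primrec g) : Primrec fun a => Nat.log (f a) (g a) := by
  have h : ∀ b n : ℕ, Nat.log b n =
      if b ≤ 1 then 0 else Nat.findGreatest (fun k => b ^ k ≤ n) n := by
    intro b n
    split_ifs with hb
    · exact Nat.log_of_left_le_one hb n
    · push Not at hb
      rcases Nat.eq_zero_or_pos n with rfl | hn
      · simp
      · symm
        rw [Nat.findGreatest_eq_iff]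
        refine ⟨Nat.log_le_self b n, fun _ => Nat.pow_log_le_self b hn.ne', fun k hk _ => ?_⟩
        exact not_le.2 (Nat.lt_pow_of_log_lt hb hk)
  simp only [h]
  have hG : Primrec fun a => Nat.findGreatest (fun k => f a ^ k ≤ g a) (g a) :=
    Primrec.nat_findGreatest (p := fun a k => f a ^ k ≤ g a) hg
      (primrecRel_iff_primrec_decide.2 (Primrec.fun_decide_le
        (f := fun q : α × ℕ => f q.1 ^ q.2) (g := fun q : α × ℕ => g q.1)
        (by fun_prop) (by fun_prop)))
  fun_prop

/-- The prime divisors of `e`, in a form that shows them to be primitive recursive. -/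
def primeDivisorList (e : ℕ) : List ℕ :=
  (List.range (e + 1)).filter fun l => decide (Nat.Prime l ∧ e % l = 0)

@[fun_prop] theorem primrec_primeDivisorList {α : Type*} [Primcodable α] {f : α → ℕ}
    (hf : Primrec f) : Primrec fun a => primeDivisorList (f a) := by
  have hprime : PrimrecPred Nat.Prime := by
    have h1 : PrimrecRel fun n y : ℕ => ∃ m < n, 2 ≤ m ∧ y % m = 0 := by
      refine PrimrecRel.exists_lt (R := fun m y => 2 ≤ m ∧ y % m = 0) ?_
      exact primrecRel_iff_primrec_decide.2
        (show Primrec fun q : ℕ × ℕ => decide (2 ≤ q.1 ∧ q.2 % q.1 = 0) by fun_prop)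
    have h2 : PrimrecPred fun n : ℕ => 2 ≤ n ∧ ¬ ∃ m < n, 2 ≤ m ∧ n % m = 0 :=
      (primrecPred_iff_primrec_decide.2
        (show Primrec fun n : ℕ => decide (2 ≤ n) by fun_prop)).and
        (PrimrecRel.comp h1 Primrec.id Primrec.id).not
    refine h2.of_eq fun n => ?_
    refine ⟨fun ⟨h, h'⟩ => Nat.prime_def_lt'.2 ⟨h, fun m hm hmn hd => ?_⟩, fun h =>
      ⟨h.two_le, fun ⟨m, hmn, hm, hd⟩ => ?_⟩⟩
    · exact h' ⟨m, hmn, hm, Nat.mod_eq_zero_of_dvd hd⟩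
    · exact (Nat.prime_def_lt'.1 h).2 m hm hmn (Nat.dvd_of_mod_eq_zero hd)
  have h : PrimrecRel fun l e : ℕ => Nat.Prime l ∧ e % l = 0 := by
    refine PrimrecPred.and (hprime.comp Primrec.fst) ?_
    exact primrecPred_iff_primrec_decide.2
      (show Primrec fun q : ℕ × ℕ => decide (q.2 % q.1 = 0) by fun_prop)
  have := h.listFilter
  exact Primrec₂.comp (f := fun L e => List.filter (fun l => decide (Nat.Prime l ∧ e % l = 0)) L)
    this (g := fun a => List.range (f a + 1)) (by fun_prop) hf

namespace SLProgram

/-! ### The programs -/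

/-- From the coefficients of `Q` to the same, followed by the array that represents `1`. -/
def initProg (e n : ℕ) : SLProgram :=
  -- The constant `1` sits at position `n + 1`, and position `n + 2` is beyond the end and reads as
  -- `0`.
  ([Instr.const 1], (List.range (n + 1 + (e * n + 1) * e)).map fun t => min t (n + 2))

/-- Keep the coefficients of `Q` and write the two factors with blocks of length `2 e`: the array
itself and the one whose entries are found at the positions `g k r`. -/
def packProg (e n : ℕ) (g : ℕ → ℕ → ℕ) : SLProgram :=
  ([], List.range (n + 1) ++
    ((List.range (2 * e * (e * n + 1))).map fun s => if s % (2 * e) < e then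
      n + 1 + (s / (2 * e) * e + s % (2 * e)) else n + 1 + (e * n + 1) * e) ++
    ((List.range (2 * e * (e * n + 1))).map fun s => if s % (2 * e) < e then
      g (s / (2 * e)) (s % (2 * e)) else n + 1 + (e * n + 1) * e))

/-- Keep the coefficients of `Q` and reduce the blocks of length `2 e` modulo `X ^ e - 1`. -/
def foldProg (e n : ℕ) : SLProgram :=
  parLayer (n + 1 + (2 * (2 * e * (e * n + 1)) - 1))
    ((List.range (n + 1)).map (fun t =>
        Instr.add t (n + 1 + (2 * (2 * e * (e * n + 1)) - 1))) ++
      -- Modulo `X ^ e - 1` the coefficients of `X ^ r` and `X ^ (r + e)` are added.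
      (List.range ((e * n + 1) * e)).map fun t =>
        Instr.add (n + 1 + (2 * e * (t / e) + t % e)) (n + 1 + (2 * e * (t / e) + (t % e + e))))

/-- Multiply the array by the one that is found at the positions `g k r`; `P` multiplies
polynomials. -/
def mulSteps (e n : ℕ) (P : SLProgram) (g : ℕ → ℕ → ℕ) : List SLProgram :=
  [packProg e n g, keep (n + 1) P, foldProg e n]

/-- The positions of the array with `Y` replaced by `x ^ m Y`. -/
def twistPos (e n m k r : ℕ) : ℕ := n + 1 + (k * e + (r + (e - m) * k) % e)

/-- The positions of the coefficients of `Q (x ^ m Y)`. -/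
def inputPos (e n m k r : ℕ) : ℕ :=
  if k ≤ n ∧ r = m * k % e then k else n + 1 + (e * n + 1) * e

/-- From the product of the first `⌊h / 2⌋` twists of `Q` to the product of the first `h`. -/
def doubleSteps (e n : ℕ) (P : SLProgram) (h : ℕ) : List SLProgram :=
  mulSteps e n P (twistPos e n (h / 2)) ++
    if h % 2 = 1 then mulSteps e n P (inputPos e n (h - 1)) else []

/-- From the coefficients of `Q` to those of the product of its `e` twists. -/
def starSteps (e n : ℕ) (P : SLProgram) : List SLProgram :=
  -- The quotients `e / 2 ^ j`, for decreasing `j`, are the numbers formed by the leading binary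
  -- digits of `e`.
  initProg e n :: (List.range (Nat.log 2 e + 1)).flatMap fun t =>
    doubleSteps e n P (e / 2 ^ (Nat.log 2 e - t))

/-- Multiply the rows of an array by `1 - x ^ (e / l)`. -/
def annihilateProg (e n l : ℕ) : SLProgram :=
  parLayer ((n + 1) * e) ((List.range ((n + 1) * e)).map fun t =>
    Instr.sub t (t / e * e + (t % e + (e - e / l)) % e))

/-- From `q (Y ^ e)` to `q`, where the coefficients are given in the ring of `e`-th roots of
unity. -/
def extractSteps (e n : ℕ) : List SLProgram :=
  ([], (List.range ((n + 1) * e)).map fun t => n + 1 + (t / e * e * e + t % e)) ::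
    ((primeDivisorList e).map (annihilateProg e n) ++ [([], (List.range (n + 1)).map (· * e))])

/-- Replace `Y ^ (p ^ (k + 1))` by `Y ^ (p ^ (k + 1)) - Y ^ (p ^ k)` once in the terms whose
`k + 1`-st digit of the exponent is at least `r`. -/
def substProg (p n k r : ℕ) : SLProgram :=
  parLayer (p * n + 1) ((List.range (p * n + 1)).map fun t =>
    Instr.sub t (if r * p ^ (k + 1) ≤ (t + (p ^ (k + 1) - p ^ k)) % p ^ (k + 2) then
      t + (p ^ (k + 1) - p ^ k) else p * n + 1))

/-- From `q` of degree at most `n` to `q (Y ^ p - Y)`. -/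
def substSteps (p n : ℕ) : List SLProgram :=
  ([], (List.range (p * n + 1)).map fun t => if t % p = 0 then t / p else n + 1) ::
    (List.range (Nat.log p n + 1)).flatMap fun k =>
      -- The threshold descends from `p - 1` to `1`, so a term whose digit is `d` is rewritten in
      -- exactly `d` of the passes.
      (List.range (p - 1)).map fun s => substProg p n k (p - 1 - s)

/-- The whole algorithm; `P` multiplies polynomials of sufficiently high degree. -/
def towerProg (p d i : ℕ) (P : SLProgram) : SLProgram :=
  seq (p ^ i * d + 1)
    ((if i = 0 ∨ (p = 2 ∧ d % 2 = 1 ∧ i = 1) then []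
      else starSteps (2 * p - 1) (p ^ i * d) P ++ extractSteps (2 * p - 1) (p ^ i * d)) ++
      substSteps p (p ^ i * d))

/-- The degree bound for the multiplications in the algorithm. -/
def mulSize (p d i : ℕ) : ℕ := 2 * (2 * p - 1) * ((2 * p - 1) * (p ^ i * d) + 1)

section

variable {α : Type*} [Primcodable α] {e n : α → ℕ} {P : α → SLProgram}

@[fun_prop] theorem primrec_mulSteps {g : α → ℕ → ℕ → ℕ} (he : Primrec e) (hn : Primrec n)
    (hP : Primrec P) (hg : Primrec fun q : α × ℕ × ℕ => g q.1 q.2.1 q.2.2) :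
    Primrec fun a => mulSteps (e a) (n a) (P a) (g a) := by
  have hg' : ∀ {β : Type _} [Primcodable β] {u : β → α} {v w : β → ℕ}, Primrec u → Primrec v →
      Primrec w → Primrec fun b => g (u b) (v b) (w b) :=
    fun hu hv hw => hg.comp (hu.pair (hv.pair hw))
  have h1 : Primrec fun a => packProg (e a) (n a) (g a) := by
    unfold packProg
    have := hg' (u := fun q : α × ℕ => q.1) (v := fun q => q.2 / (2 * e q.1))
      (w := fun q => q.2 % (2 * e q.1)) (by fun_prop) (by fun_prop) (by fun_prop)
    fun_prop
  have h2 : Primrec fun a => foldProg (e a) (n a) := by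
    unfold foldProg
    fun_prop
  unfold mulSteps
  fun_prop

@[fun_prop] theorem primrec_doubleSteps {h : α → ℕ} (he : Primrec e) (hn : Primrec n)
    (hP : Primrec P) (hh : Primrec h) :
    Primrec fun a => doubleSteps (e a) (n a) (P a) (h a) := by
  have h1 : Primrec fun a => mulSteps (e a) (n a) (P a) (twistPos (e a) (n a) (h a / 2)) := by
    unfold twistPos
    fun_prop
  have h2 : Primrec fun a => mulSteps (e a) (n a) (P a) (inputPos (e a) (n a) (h a - 1)) := by
    unfold inputPos
    fun_prop
  unfold doubleSteps
  fun_prop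

@[fun_prop] theorem primrec_starSteps (he : Primrec e) (hn : Primrec n) (hP : Primrec P) :
    Primrec fun a => starSteps (e a) (n a) (P a) := by
  unfold starSteps initProg
  fun_prop

@[fun_prop] theorem primrec_extractSteps (he : Primrec e) (hn : Primrec n) :
    Primrec fun a => extractSteps (e a) (n a) := by
  unfold extractSteps annihilateProg
  fun_prop

@[fun_prop] theorem primrec_substSteps (he : Primrec e) (hn : Primrec n) :
    Primrec fun a => substSteps (e a) (n a) := by
  unfold substSteps substProg
  fun_prop

end

theorem primrec_towerProg :
    Primrec fun a : (ℕ × ℕ × ℕ) × SLProgram => towerProg a.1.1 a.1.2.1 a.1.2.2 a.2 := by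
  unfold towerProg
  fun_prop

theorem computable_towerProg {mulAlg : ℕ × ℕ → SLProgram} (h : Computable mulAlg) :
    Computable fun a : ℕ × ℕ × ℕ =>
      towerProg a.1 a.2.1 a.2.2 (mulAlg (a.1, mulSize a.1 a.2.1 a.2.2)) := by
  have hs : Primrec fun a : ℕ × ℕ × ℕ => (a.1, mulSize a.1 a.2.1 a.2.2) := by
    unfold mulSize
    fun_prop
  -- All that surrounds the multiplication program is primitive recursive; `mulAlg` is merely
  -- computable.
  exact Computable.comp
    (f := fun a : (ℕ × ℕ × ℕ) × SLProgram => towerProg a.1.1 a.1.2.1 a.1.2.2 a.2)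
    (g := fun a : ℕ × ℕ × ℕ => (a, mulAlg (a.1, mulSize a.1 a.2.1 a.2.2)))
    primrec_towerProg.to_comp (Computable.id.pair (h.comp hs.to_comp))

end SLProgram

/-! ### Frobenius orbits -/

section Frobenius

open Function

variable {p : ℕ} [Fact p.Prime]

theorem Finset.sum_range_mul_eq {M : Type*} [AddCommMonoid M] (f : ℕ → M) (n s : ℕ) :
    ∑ k ∈ Finset.range (n * s), f k =
      ∑ j ∈ Finset.range s, ∑ k ∈ Finset.range n, f (n * j + k) := by
  induction s with
  | zero => simp
  | succ s ih => rw [Nat.mul_succ, Finset.sum_range_add, ih, Finset.sum_range_succ]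

theorem ZMod.sum_range_cast {M : Type*} [AddCommMonoid M] (f : ZMod p → M) :
    ∑ s ∈ Finset.range p, f s = ∑ c, f c := by
  refine Finset.sum_nbij' (fun s => (s : ZMod p)) ZMod.val (fun _ _ => Finset.mem_univ _)
    (fun c _ => Finset.mem_range.2 (ZMod.val_lt c)) (fun s hs => ?_) (fun c _ => ?_)
    (fun _ _ => rfl)
  · exact ZMod.val_cast_of_lt (Finset.mem_range.1 hs)
  · exact ZMod.natCast_zmod_val c

theorem ZMod.sum_univ_eq_zero (hp : p ≠ 2) : ∑ c : ZMod p, c = 0 := by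
  have h2 := (Fact.out : p.Prime).two_le
  simpa using FiniteField.sum_pow_lt_card_sub_one (ZMod p) 1 (by rw [ZMod.card]; omega)

variable {K : Type*} [Field K] [CharP K p] {x γ : K}

/-- The sum of the first `n` conjugates of `x`. -/
def frobeniusSum (K : Type*) [Field K] (p : ℕ) [Fact p.Prime] [CharP K p] (n : ℕ) (x : K) : K :=
  ∑ k ∈ Finset.range n, (frobenius K p)^[k] x

/-- Frobenius permutes the summands cyclically; hence this trace lies in the prime field. -/
theorem frobenius_frobeniusSum {n : ℕ} {x : K} (h : IsPeriodicPt (frobenius K p) n x) :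
    frobenius K p (frobeniusSum K p n x) = frobeniusSum K p n x := by
  have h1 : frobenius K p (frobeniusSum K p n x) =
      ∑ k ∈ Finset.range n, (frobenius K p)^[k + 1] x := by
    simp only [frobeniusSum, map_sum, iterate_succ_apply']
  have h2 := Finset.sum_range_succ (fun k => (frobenius K p)^[k] x) n
  rw [Finset.sum_range_succ', ← h1, h.eq] at h2
  simpa [frobeniusSum] using h2

theorem iterate_frobenius_eq_add (hx : x ^ p - x = γ) (k : ℕ) :
    (frobenius K p)^[k] x = x + frobeniusSum K p k γ := by
  induction k with
  | zero => simp [frobeniusSum]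
  | succ k ih =>
    have h : frobenius K p x = x + γ := by rw [frobenius_def, ← hx]; ring
    rw [iterate_succ_apply, h, iterate_map_add, ih, frobeniusSum, frobeniusSum,
      Finset.sum_range_succ, add_assoc]

theorem iterate_frobenius_mul_eq (hx : x ^ p - x = γ) {n : ℕ}
    (hn : IsPeriodicPt (frobenius K p) n γ) (s : ℕ) :
    (frobenius K p)^[n * s] x = x + s * frobeniusSum K p n γ := by
  have hT : ∀ k, (frobenius K p)^[k] (frobeniusSum K p n γ) = frobeniusSum K p n γ :=
    fun k => iterate_fixed (frobenius_frobeniusSum hn) k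
  induction s with
  | zero => simp
  | succ s ih =>
    rw [Nat.mul_succ, iterate_add_apply, iterate_frobenius_eq_add hx, iterate_map_add, ih, hT]
    push_cast
    ring

/-- Transitivity of the trace: the inner sum is the relative one. -/
theorem frobeniusSum_mul_eq (n s : ℕ) (y : K) :
    frobeniusSum K p (n * s) y =
      frobeniusSum K p n (∑ j ∈ Finset.range s, (frobenius K p)^[n * j] y) := by
  simp only [frobeniusSum]
  have h : ∀ k, (frobenius K p)^[k] (∑ j ∈ Finset.range s, (frobenius K p)^[n * j] y) =
      ∑ j ∈ Finset.range s, (frobenius K p)^[n * j + k] y := by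
    intro k
    rw [← RingHom.coe_pow, map_sum]
    simp only [RingHom.coe_pow, ← iterate_add_apply, add_comm]
  rw [Finset.sum_range_mul_eq, Finset.sum_comm]
  simp only [h]

/-- A period of `x` is also one of `γ`, hence of the form `n s`; and `x + s T = x` with `T ≠ 0`
forces `p ∣ s`. -/
theorem minimalPeriod_frobenius_artinSchreier (hx : x ^ p - x = γ)
    (hT : frobeniusSum K p (minimalPeriod (frobenius K p) γ) γ ≠ 0) :
    minimalPeriod (frobenius K p) x = p * minimalPeriod (frobenius K p) γ := by
  set n := minimalPeriod (frobenius K p) γ with hn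
  have hper : IsPeriodicPt (frobenius K p) n γ := isPeriodicPt_minimalPeriod _ _
  refine Nat.dvd_antisymm ?_ ?_
  · refine IsPeriodicPt.minimalPeriod_dvd ?_
    rw [IsPeriodicPt, IsFixedPt, mul_comm, iterate_frobenius_mul_eq hx hper]
    simp
  · set m := minimalPeriod (frobenius K p) x with hm
    have hmx : (frobenius K p)^[m] x = x := iterate_minimalPeriod
    have hmγ : IsPeriodicPt (frobenius K p) m γ := by
      rw [IsPeriodicPt, IsFixedPt, ← hx, iterate_map_sub, iterate_map_pow, hmx]
    obtain ⟨s, hs⟩ := hmγ.minimalPeriod_dvd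
    rw [← hn] at hs
    rw [hs, iterate_frobenius_mul_eq hx hper, add_eq_left, mul_eq_zero, or_iff_left hT,
      CharP.cast_eq_zero_iff K p] at hmx
    rw [hs, mul_comm]
    exact Nat.mul_dvd_mul_left n hmx

/-- The relative trace is `x + (x + T) = T`, and summing `T` an odd number `n` of times gives `T` in
characteristic two. This serves the exceptional linear step. -/
theorem frobeniusSum_two_mul_ne_zero (hp2 : p = 2) (hx : x ^ p - x = γ) {n : ℕ} (hodd : Odd n)
    (hn : IsPeriodicPt (frobenius K p) n γ) (hT : frobeniusSum K p n γ ≠ 0) :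
    frobeniusSum K p (p * n) x ≠ 0 := by
  have h2 : (2 : K) = 0 := by
    have := CharP.cast_eq_zero K p
    rw [hp2] at this
    exact_mod_cast this
  have h1 : (n : K) = 1 := by
    obtain ⟨k, rfl⟩ := hodd
    push_cast
    rw [h2]; ring
  have hR : ∑ j ∈ Finset.range p, (frobenius K p)^[n * j] x = frobeniusSum K p n γ := by
    simp only [iterate_frobenius_mul_eq hx hn]
    rw [show Finset.range p = Finset.range 2 by rw [hp2], Finset.sum_range_succ,
      Finset.sum_range_one]
    push_cast
    linear_combination x * h2
  rw [mul_comm, frobeniusSum_mul_eq, hR, frobeniusSum]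
  simp only [iterate_fixed (frobenius_frobeniusSum hn)]
  simpa [h1] using hT

variable [Algebra (ZMod p) K]

/-- In the binomial expansion the power sums of `𝔽_p` of exponent below `p - 1` vanish, and the one
of exponent `p - 1` is `-1`. -/
theorem sum_add_algebraMap_pow_pred (x : K) :
    ∑ c : ZMod p, (x + algebraMap (ZMod p) K c) ^ (p - 1) = -1 := by
  have hp := (Fact.out : p.Prime)
  simp only [add_pow]
  rw [Finset.sum_comm, Nat.sub_add_cancel hp.one_le]
  rw [Finset.sum_eq_single 0]
  · simp only [pow_zero, one_mul, Nat.choose_zero_right, Nat.cast_one, mul_one, Nat.sub_zero]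
    have h : ∀ c : ZMod p, (algebraMap (ZMod p) K c) ^ (p - 1) = 1 - if c = 0 then 1 else 0 := by
      intro c
      split_ifs with hc
      · rw [hc, map_zero, zero_pow (by have := hp.two_le; omega), sub_self]
      · rw [← map_pow, ZMod.pow_card_sub_one_eq_one hc, map_one, sub_zero]
    simp [h, Finset.sum_sub_distrib]
  · intro j hj hj0
    rw [Finset.mem_range] at hj
    rw [← Finset.sum_mul, ← Finset.mul_sum]
    have := FiniteField.sum_pow_lt_card_sub_one (ZMod p) (p - 1 - j) (by rw [ZMod.card]; omega)
    simp only [← map_pow, ← map_sum]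
    rw [this]
    simp
  · intro h
    exact absurd (Finset.mem_range.2 hp.pos) h

/-- With `γ = x ^ p - x` one has `(x + c) ^ p = (x + c) + γ`, which reduces the exponent `2 p - 1 =
p + (p - 1)` to `1`, `0` and `p - 1`. -/
theorem sum_add_algebraMap_pow (x : K) :
    ∑ c : ZMod p, (x + algebraMap (ZMod p) K c) ^ (2 * p - 1) =
      algebraMap (ZMod p) K (∑ c, c) - (x ^ p - x) := by
  have hp := (Fact.out : p.Prime)
  have h : ∀ c : ZMod p, (x + algebraMap (ZMod p) K c) ^ (2 * p - 1) =
      (x + algebraMap (ZMod p) K c) + (x ^ p - x) +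
        (x ^ p - x) * (x + algebraMap (ZMod p) K c) ^ (p - 1) := by
    intro c
    have h1 : (x + algebraMap (ZMod p) K c) ^ p =
        (x + algebraMap (ZMod p) K c) + (x ^ p - x) := by
      rw [add_pow_char, ← map_pow, ZMod.pow_card]
      ring
    have h2 : 2 * p - 1 = p + (p - 1) := by have := hp.one_le; omega
    have h3 : (x + algebraMap (ZMod p) K c) * (x + algebraMap (ZMod p) K c) ^ (p - 1) =
        (x + algebraMap (ZMod p) K c) ^ p := mul_pow_sub_one hp.ne_zero _
    rw [h2, pow_add, h1, add_mul, h3, h1]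
  simp only [h]
  rw [Finset.sum_add_distrib, Finset.sum_add_distrib, Finset.sum_add_distrib, ← Finset.mul_sum,
    sum_add_algebraMap_pow_pred, ← map_sum]
  simp
  ring

theorem exists_algebraMap_eq_of_pow_eq {x : K} (h : x ^ p = x) :
    ∃ c : ZMod p, algebraMap (ZMod p) K c = x := by
  have h1 := (Subfield.mem_bot_iff_pow_eq_self (F := K) (p := p)).2 h
  rw [Subfield.bot_eq_of_zMod_algebra p] at h1
  exact h1


/-- The conjugates `x + s T` run through all `x + c`, because `T` is a nonzero element of `𝔽_p`. -/
theorem sum_iterate_frobenius_pow (hx : x ^ p - x = γ) {n : ℕ}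
    (hn : IsPeriodicPt (frobenius K p) n γ) (hT : frobeniusSum K p n γ ≠ 0) :
    ∑ s ∈ Finset.range p, (frobenius K p)^[n * s] (x ^ (2 * p - 1)) =
      algebraMap (ZMod p) K (∑ c, c) - γ := by
  obtain ⟨t, ht⟩ := exists_algebraMap_eq_of_pow_eq (p := p) (frobenius_frobeniusSum hn)
  have ht0 : t ≠ 0 := by rintro rfl; exact hT (by rw [← ht, map_zero])
  have h : ∀ s : ℕ, (frobenius K p)^[n * s] (x ^ (2 * p - 1)) =
      (x + algebraMap (ZMod p) K (s * t)) ^ (2 * p - 1) := by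
    intro s
    rw [iterate_map_pow, iterate_frobenius_mul_eq hx hn, map_mul, map_natCast, ht]
  simp only [h]
  rw [ZMod.sum_range_cast (fun c : ZMod p => (x + algebraMap (ZMod p) K (c * t)) ^ (2 * p - 1)),
    ← hx, ← sum_add_algebraMap_pow]
  exact Fintype.sum_equiv (Equiv.mulRight₀ t ht0) _ _ fun c => rfl

theorem natCast_mul_sum_univ {n : ℕ} (hn2 : p = 2 → Even n) :
    (n : K) * algebraMap (ZMod p) K (∑ c, c) = 0 := by
  rcases eq_or_ne p 2 with h | h
  · have : (n : K) = 0 := by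
      rw [CharP.cast_eq_zero_iff K p, h]
      exact (hn2 h).two_dvd
    rw [this, zero_mul]
  · rw [ZMod.sum_univ_eq_zero h, map_zero, mul_zero]

theorem frobeniusSum_sub_algebraMap (n : ℕ) (c : ZMod p) (γ : K) :
    frobeniusSum K p n (algebraMap (ZMod p) K c - γ) =
      n * algebraMap (ZMod p) K c - frobeniusSum K p n γ := by
  have h : ∀ k, (frobenius K p)^[k] (algebraMap (ZMod p) K c) = algebraMap (ZMod p) K c := by
    intro k
    refine iterate_fixed ?_ k
    rw [frobenius_def, ← map_pow, ZMod.pow_card]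
  simp only [frobeniusSum, iterate_map_sub, h, Finset.sum_sub_distrib, Finset.sum_const,
    Finset.card_range, nsmul_eq_mul]

theorem frobeniusSum_pow_ne_zero (hx : x ^ p - x = γ) {n : ℕ}
    (hn : IsPeriodicPt (frobenius K p) n γ) (hT : frobeniusSum K p n γ ≠ 0)
    (hn2 : p = 2 → Even n) : frobeniusSum K p (p * n) (x ^ (2 * p - 1)) ≠ 0 := by
  rw [mul_comm, frobeniusSum_mul_eq, sum_iterate_frobenius_pow hx hn hT,
    frobeniusSum_sub_algebraMap, natCast_mul_sum_univ hn2, zero_sub]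
  exact neg_ne_zero.2 hT

/-- The relative trace `∑ c - γ` is fixed by every period `m` of `x ^ (2 p - 1)`, so `n ∣ m`; also
`m ∣ p n`, and only `m = n` has to be excluded. -/
theorem minimalPeriod_frobenius_pow (hx : x ^ p - x = γ)
    (hT : frobeniusSum K p (minimalPeriod (frobenius K p) γ) γ ≠ 0)
    (hn2 : p = 2 → Even (minimalPeriod (frobenius K p) γ)) :
    minimalPeriod (frobenius K p) (x ^ (2 * p - 1)) =
      p * minimalPeriod (frobenius K p) γ := by
  have hp := (Fact.out : p.Prime)
  have hx' := minimalPeriod_frobenius_artinSchreier hx hT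
  set n := minimalPeriod (frobenius K p) γ with hn
  have hper : IsPeriodicPt (frobenius K p) n γ := isPeriodicPt_minimalPeriod _ _
  have hR := sum_iterate_frobenius_pow hx hper hT
  set m := minimalPeriod (frobenius K p) (x ^ (2 * p - 1)) with hm
  have hδ : (frobenius K p)^[m] (x ^ (2 * p - 1)) = x ^ (2 * p - 1) := iterate_minimalPeriod
  have hmp : m ∣ p * n := by
    rw [← hx']
    refine IsPeriodicPt.minimalPeriod_dvd ?_
    rw [IsPeriodicPt, IsFixedPt, iterate_map_pow, iterate_minimalPeriod]
  have hnm : n ∣ m := by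
    refine IsPeriodicPt.minimalPeriod_dvd ?_
    have h1 := congrArg (frobenius K p)^[m] hR
    have h2 : (frobenius K p)^[m] (∑ s ∈ Finset.range p,
        (frobenius K p)^[n * s] (x ^ (2 * p - 1))) =
        ∑ s ∈ Finset.range p, (frobenius K p)^[n * s] (x ^ (2 * p - 1)) := by
      rw [← RingHom.coe_pow, map_sum]
      refine Finset.sum_congr rfl fun s _ => ?_
      rw [RingHom.coe_pow, ← iterate_add_apply, add_comm, iterate_add_apply, hδ]
    rw [h2, hR, iterate_map_sub, iterate_fixed (x := algebraMap (ZMod p) K _)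
      (by rw [frobenius_def, ← map_pow, ZMod.pow_card]), sub_right_inj] at h1
    exact h1.symm
  obtain ⟨s, hs⟩ := hnm
  have hn0 : 0 < n := by
    rcases Nat.eq_zero_or_pos n with h | h
    · rw [h] at hT; simp [frobeniusSum] at hT
    · exact h
  rw [hs, mul_comm p n, Nat.mul_dvd_mul_iff_left hn0, Nat.dvd_prime hp] at hmp
  rcases hmp with rfl | rfl
  -- If `m = n`, the relative trace is a sum of `p` equal terms, hence zero; then `γ = ∑ c` would
  -- have trace `n ∑ c = 0`.
  · exfalso
    rw [mul_one] at hs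
    have h1 : ∀ s : ℕ, (frobenius K p)^[n * s] (x ^ (2 * p - 1)) = x ^ (2 * p - 1) := by
      intro s
      have : IsPeriodicPt (frobenius K p) n (x ^ (2 * p - 1)) := hs ▸ hδ
      exact this.mul_const s
    simp only [h1, Finset.sum_const, Finset.card_range, nsmul_eq_mul, CharP.cast_eq_zero,
      zero_mul] at hR
    have h2 := frobeniusSum_sub_algebraMap n (∑ c : ZMod p, c) γ
    rw [← hR, natCast_mul_sum_univ hn2, zero_sub, eq_neg_iff_add_eq_zero] at h2
    refine hT ?_
    rw [← h2, right_eq_add]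
    simp only [frobeniusSum, iterate_map_zero, Finset.sum_const_zero]
  · rw [hs, mul_comm]

/-- The product over the orbit is invariant under Frobenius and thus has coefficients in `𝔽_p`. Its
roots are distinct, since they lie within one period, and all are roots of the minimal polynomial.
-/
theorem minpoly_map_eq_prod {x : K} {n : ℕ} (hn : minimalPeriod (frobenius K p) x = n)
    (hn0 : n ≠ 0) : (minpoly (ZMod p) x).map (algebraMap (ZMod p) K) =
      ∏ k ∈ Finset.range n, (X - C ((frobenius K p)^[k] x)) := by
  have hper : (frobenius K p)^[n] x = x := by rw [← hn]; exact iterate_minimalPeriod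
  set P : K[X] := ∏ k ∈ Finset.range n, (X - C ((frobenius K p)^[k] x)) with hP
  have hPm : P.Monic := monic_prod_of_monic _ _ fun _ _ => monic_X_sub_C _
  have hPfix : P.map (frobenius K p) = P := by
    have h1 : P.map (frobenius K p) =
        ∏ k ∈ Finset.range n, (X - C ((frobenius K p)^[k + 1] x)) := by
      simp only [hP, Polynomial.map_prod, Polynomial.map_sub, map_X, map_C, iterate_succ_apply']
    have h2 := Finset.prod_range_succ (fun k => (X - C ((frobenius K p)^[k] x))) n
    rw [Finset.prod_range_succ', ← h1, hper, iterate_zero_apply] at h2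
    exact mul_right_cancel₀ (X_sub_C_ne_zero x) h2
  have hlift : P ∈ lifts (algebraMap (ZMod p) K) := by
    rw [lifts_iff_coeff_lifts]
    intro k
    refine exists_algebraMap_eq_of_pow_eq ?_
    conv_rhs => rw [← hPfix, coeff_map, frobenius_def]
  obtain ⟨q, hq, -, hqm⟩ := lifts_and_natDegree_eq_and_monic hlift hPm
  have hroot : aeval x q = 0 := by
    rw [← eval_map_algebraMap, hq, hP, eval_prod]
    exact Finset.prod_eq_zero (Finset.mem_range.2 (Nat.pos_of_ne_zero hn0)) (by simp)
  have hint : IsIntegral (ZMod p) x := ⟨q, hqm, by rwa [← aeval_def]⟩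
  refine eq_of_monic_of_associated ((minpoly.monic hint).map _) hPm
    (associated_of_dvd_dvd ?_ ?_)
  · rw [← hq]
    exact Polynomial.map_dvd _ (minpoly.dvd _ _ hroot)
  · refine Finset.prod_dvd_of_coprime ?_ ?_
    · intro i hi j hj hij
      refine isCoprime_X_sub_C_of_isUnit_sub ?_
      rw [isUnit_iff_ne_zero, sub_ne_zero]
      intro h
      refine hij (iterate_injOn_Iio_minimalPeriod ?_ ?_ h)
      · rw [hn]; simpa using hi
      · rw [hn]; simpa using hj
    · intro k _
      rw [dvd_iff_isRoot, IsRoot, eval_map_algebraMap]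
      have h1 : aeval ((frobenius K p)^[k] x) (minpoly (ZMod p) x) =
          (frobenius K p)^[k] (aeval x (minpoly (ZMod p) x)) := by
        rw [← RingHom.coe_pow, aeval_def, aeval_def, hom_eval₂]
        congr 1
        exact Subsingleton.elim _ _
      rw [h1, minpoly.aeval, iterate_map_zero]

theorem natDegree_minpoly_eq_minimalPeriod {x : K} {n : ℕ}
    (hn : minimalPeriod (frobenius K p) x = n) (hn0 : n ≠ 0) :
    (minpoly (ZMod p) x).natDegree = n := by
  rw [← natDegree_map (algebraMap (ZMod p) K), minpoly_map_eq_prod hn hn0,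
    natDegree_prod_of_monic _ _ fun _ _ => monic_X_sub_C _]
  simp

end Frobenius

/-! ### The tower -/

section Tower

open Function

variable {p : ℕ} [Fact p.Prime]

/-- `𝔽_p(x)` is finite with `p ^ k` elements, so the `k`-th iterate of Frobenius fixes `x`. -/
theorem minimalPeriod_frobenius_ne_zero {K : Type*} [Field K] [CharP K p] [Algebra (ZMod p) K]
    {x : K} (hx : IsIntegral (ZMod p) x) : minimalPeriod (frobenius K p) x ≠ 0 := by
  have hfd := IntermediateField.adjoin.finiteDimensional hx
  have hfin : Finite (IntermediateField.adjoin (ZMod p) {x}) := Module.finite_of_finite (ZMod p)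
  have := Fintype.ofFinite (IntermediateField.adjoin (ZMod p) {x})
  have hch : CharP (IntermediateField.adjoin (ZMod p) {x}) p :=
    charP_of_injective_algebraMap (algebraMap (ZMod p) _).injective p
  obtain ⟨k, -, hk⟩ := FiniteField.card (IntermediateField.adjoin (ZMod p) {x}) p
  have h := FiniteField.pow_card (IntermediateField.AdjoinSimple.gen (ZMod p) x)
  rw [hk] at h
  have h' := congrArg (algebraMap _ K) h
  rw [map_pow, IntermediateField.AdjoinSimple.algebraMap_gen] at h'
  refine (IsPeriodicPt.minimalPeriod_pos k.pos ?_).ne'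
  rw [IsPeriodicPt, IsFixedPt, iterate_frobenius, h']

/-- A sequence in an algebraic closure of `𝔽_p` that satisfies the equations of the tower. -/
structure IsTowerSeq (p : ℕ) [Fact p.Prime] (Q₀ : (ZMod p)[X])
    (a : ℕ → AlgebraicClosure (ZMod p)) : Prop where
  root : aeval (a 0) Q₀ = 0
  step (j : ℕ) : a (j + 1) ^ p - a (j + 1) = a j ^ stepExponent p Q₀.natDegree j

theorem exists_isTowerSeq {Q₀ : (ZMod p)[X]} (hQ : Irreducible Q₀) :
    ∃ a, IsTowerSeq p Q₀ a := by
  have hp := (Fact.out : p.Prime)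
  obtain ⟨b, hb⟩ := IsAlgClosed.exists_aeval_eq_zero (AlgebraicClosure (ZMod p)) Q₀
    (degree_pos_of_irreducible hQ).ne'
  have h : ∀ y : AlgebraicClosure (ZMod p), ∃ z, z ^ p - z = y := by
    intro y
    have hd : (X ^ p - X - C y : (AlgebraicClosure (ZMod p))[X]).natDegree = p := by
      rw [natDegree_sub_C, FiniteField.X_pow_card_sub_X_natDegree_eq _ hp.one_lt]
    obtain ⟨z, hz⟩ := IsAlgClosed.exists_root (X ^ p - X - C y : (AlgebraicClosure (ZMod p))[X])
      (by
        intro h0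
        have := natDegree_eq_of_degree_eq_some (n := 0) h0
        rw [hd] at this
        exact hp.ne_zero this)
    exact ⟨z, by simpa [sub_eq_zero] using hz⟩
  choose g hg using h
  exact ⟨fun j => Nat.rec b (fun j y => g (y ^ stepExponent p Q₀.natDegree j)) j, hb,
    fun j => hg _⟩

variable {Q₀ : (ZMod p)[X]} {a : ℕ → AlgebraicClosure (ZMod p)}

theorem natDegree_minpoly_eq_of_root {x : AlgebraicClosure (ZMod p)} (hQ : Irreducible Q₀)
    (hx : aeval x Q₀ = 0) : (minpoly (ZMod p) x).natDegree = Q₀.natDegree := by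
  rw [← minpoly.eq_of_irreducible hQ hx]
  exact natDegree_mul_leadingCoeff_inv _ hQ.ne_zero

/-- Up to sign, both traces are the second highest coefficient of the minimal polynomial. -/
theorem frobeniusSum_ne_zero_of_trace {x : AlgebraicClosure (ZMod p)} (hQ : Irreducible Q₀)
    (hx : aeval x Q₀ = 0)
    (htr : Algebra.trace (ZMod p) (AdjoinRoot Q₀) (AdjoinRoot.root Q₀) ≠ 0) :
    frobeniusSum (AlgebraicClosure (ZMod p)) p
      (minimalPeriod (frobenius (AlgebraicClosure (ZMod p)) p) x) x ≠ 0 := by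
  have hint : IsIntegral (ZMod p) x := Algebra.IsIntegral.isIntegral x
  have := Fact.mk hQ
  have h0 := minimalPeriod_frobenius_ne_zero hint
  intro h
  refine htr ?_
  have h1 := PowerBasis.trace_gen_eq_nextCoeff_minpoly (AdjoinRoot.powerBasis hQ.ne_zero)
  rw [AdjoinRoot.powerBasis_gen, AdjoinRoot.minpoly_root hQ.ne_zero,
    minpoly.eq_of_irreducible hQ hx] at h1
  rw [h1, neg_eq_zero]
  refine (algebraMap (ZMod p) (AlgebraicClosure (ZMod p))).injective ?_
  rw [← nextCoeff_map (algebraMap (ZMod p) (AlgebraicClosure (ZMod p))).injective,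
    minpoly_map_eq_prod rfl h0, prod_X_sub_C_nextCoeff, map_zero, neg_eq_zero]
  exact h

/-- The period and the nonzero trace of `γ_j` are the invariant that lets the induction climb the
tower. -/
theorem IsTowerSeq.orbit (ha : IsTowerSeq p Q₀ a) (hQ : Irreducible Q₀)
    (htr : Algebra.trace (ZMod p) (AdjoinRoot Q₀) (AdjoinRoot.root Q₀) ≠ 0) (j : ℕ) :
    minimalPeriod (frobenius (AlgebraicClosure (ZMod p)) p) (a j) = p ^ j * Q₀.natDegree ∧
    minimalPeriod (frobenius (AlgebraicClosure (ZMod p)) p)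
      (a j ^ stepExponent p Q₀.natDegree j) = p ^ j * Q₀.natDegree ∧
    frobeniusSum (AlgebraicClosure (ZMod p)) p (p ^ j * Q₀.natDegree)
      (a j ^ stepExponent p Q₀.natDegree j) ≠ 0 := by
  induction j with
  | zero =>
    have h1 : minimalPeriod (frobenius (AlgebraicClosure (ZMod p)) p) (a 0) = Q₀.natDegree := by
      rw [← natDegree_minpoly_eq_of_root hQ ha.root, natDegree_minpoly_eq_minimalPeriod rfl
        (minimalPeriod_frobenius_ne_zero (Algebra.IsIntegral.isIntegral (a 0)))]
    have h2 := frobeniusSum_ne_zero_of_trace hQ ha.root htr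
    have he : stepExponent p Q₀.natDegree 0 = 1 := by simp [stepExponent, IsLinearStep]
    rw [he, pow_one, pow_zero, one_mul]
    exact ⟨h1, h1, h1 ▸ h2⟩
  | succ j ih =>
    obtain ⟨-, h2, h3⟩ := ih
    have hx := ha.step j
    have h3' : frobeniusSum (AlgebraicClosure (ZMod p)) p
      (minimalPeriod (frobenius (AlgebraicClosure (ZMod p)) p)
        (a j ^ stepExponent p Q₀.natDegree j)) (a j ^ stepExponent p Q₀.natDegree j) ≠ 0 := by
      rwa [h2]
    have hper : IsPeriodicPt (frobenius (AlgebraicClosure (ZMod p)) p) (p ^ j * Q₀.natDegree)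
        (a j ^ stepExponent p Q₀.natDegree j) := h2 ▸ isPeriodicPt_minimalPeriod _ _
    have h4 := minimalPeriod_frobenius_artinSchreier hx h3'
    have h5 : p ^ (j + 1) * Q₀.natDegree = p * (p ^ j * Q₀.natDegree) := by ring
    rw [h2, ← h5] at h4
    refine ⟨h4, ?_⟩
    by_cases hl : IsLinearStep p Q₀.natDegree (j + 1)
    · have he : stepExponent p Q₀.natDegree (j + 1) = 1 := by simp [stepExponent, hl]
      rw [he, pow_one]
      refine ⟨h4, ?_⟩
      rcases hl with hl | ⟨hp2, hodd, hj⟩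
      · omega
      · rw [h5]
        obtain rfl : j = 0 := by omega
        exact frobeniusSum_two_mul_ne_zero hp2 hx (by simpa using hodd) hper h3
    · have he : stepExponent p Q₀.natDegree (j + 1) = 2 * p - 1 := by simp [stepExponent, hl]
      -- An odd `2 ^ j d` means `d` odd and `j = 0`, so that step `j + 1 = 1` would be linear.
      have hev : p = 2 → Even (p ^ j * Q₀.natDegree) := by
        intro hp2
        by_contra hodd
        rw [Nat.not_even_iff_odd, Nat.odd_mul] at hodd
        refine hl (Or.inr ⟨hp2, hodd.2, ?_⟩)
        by_contra hj
        have h6 : j ≠ 0 := by omega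
        have h7 := hodd.1.of_dvd_nat (dvd_pow_self p h6)
        rw [hp2] at h7
        exact absurd h7 (by decide)
      rw [he]
      refine ⟨?_, ?_⟩
      · rw [minimalPeriod_frobenius_pow hx h3' (by rwa [h2]), h2, h5]
      · rw [h5]
        exact frobeniusSum_pow_ne_zero hx hper h3 hev

theorem monic_X_pow_sub_X : (X ^ p - X : (ZMod p)[X]).Monic := by
  have hp := (Fact.out : p.Prime)
  exact monic_X_pow_sub (by rw [degree_X]; exact_mod_cast hp.one_lt)

/-- The right side is monic, vanishes at `a (j + 1)`, and has degree `p ^ (j + 1) d`, which is the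
degree of `a (j + 1)`. -/
theorem IsTowerSeq.minpoly_succ (ha : IsTowerSeq p Q₀ a) (hQ : Irreducible Q₀)
    (htr : Algebra.trace (ZMod p) (AdjoinRoot Q₀) (AdjoinRoot.root Q₀) ≠ 0) (j : ℕ) :
    minpoly (ZMod p) (a (j + 1)) =
      (minpoly (ZMod p) (a j ^ stepExponent p Q₀.natDegree j)).comp (X ^ p - X) := by
  have hp := (Fact.out : p.Prime)
  have hd0 := hQ.natDegree_pos.ne'
  obtain ⟨-, h1, -⟩ := ha.orbit hQ htr j
  obtain ⟨h2, -, -⟩ := ha.orbit hQ htr (j + 1)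
  have hdeg : (X ^ p - X : (ZMod p)[X]).natDegree = p :=
    FiniteField.X_pow_card_sub_X_natDegree_eq _ hp.one_lt
  symm
  refine eq_of_monic_of_dvd_of_natDegree_le (minpoly.monic (Algebra.IsIntegral.isIntegral _))
    ?_ (minpoly.dvd _ _ ?_) ?_
  · exact (minpoly.monic (Algebra.IsIntegral.isIntegral _)).comp monic_X_pow_sub_X
      (by rw [hdeg]; exact hp.ne_zero)
  · rw [aeval_comp]
    simp only [map_sub, map_pow, aeval_X]
    rw [ha.step j, minpoly.aeval]
  · rw [natDegree_comp, hdeg,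
      natDegree_minpoly_eq_minimalPeriod h1 (mul_ne_zero (pow_ne_zero _ hp.ne_zero) hd0),
      natDegree_minpoly_eq_minimalPeriod h2 (mul_ne_zero (pow_ne_zero _ hp.ne_zero) hd0)]
    exact le_of_eq (by ring)

theorem towerIdeal_mk_insert (i : ℕ) :
    aeval (Ideal.Quotient.mk (towerIdeal p Q₀ i) (MvPolynomial.X 0)) Q₀ = 0 := by
  have h : Polynomial.aeval (MvPolynomial.X 0 : MvPolynomial (Fin (i + 1)) (ZMod p)) Q₀ ∈
      towerIdeal p Q₀ i := Ideal.subset_span (Set.mem_insert _ _)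
  rw [← Ideal.Quotient.eq_zero_iff_mem] at h
  rw [← h]
  exact Polynomial.aeval_algHom_apply (Ideal.Quotient.mkₐ (ZMod p) (towerIdeal p Q₀ i)) _ _

theorem towerIdeal_mk_step {i : ℕ} (j : Fin i) :
    Ideal.Quotient.mk (towerIdeal p Q₀ i) (MvPolynomial.X j.succ) ^ p -
      Ideal.Quotient.mk (towerIdeal p Q₀ i) (MvPolynomial.X j.succ) =
    Ideal.Quotient.mk (towerIdeal p Q₀ i) (MvPolynomial.X j.castSucc) ^
      stepExponent p Q₀.natDegree j := by
  have h : (MvPolynomial.X j.succ ^ p - MvPolynomial.X j.succ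
          - MvPolynomial.X j.castSucc ^ stepExponent p Q₀.natDegree j :
            MvPolynomial (Fin (i + 1)) (ZMod p)) ∈ towerIdeal p Q₀ i :=
    Ideal.subset_span (Set.mem_insert_of_mem _ ⟨j, rfl⟩)
  rw [← Ideal.Quotient.eq_zero_iff_mem, map_sub, sub_eq_zero] at h
  simpa using h

/-- Evaluation at the sequence `a` maps the level to a field. -/
theorem IsTowerSeq.nontrivial_towerLevel (ha : IsTowerSeq p Q₀ a) (i : ℕ) :
    Nontrivial (TowerLevel p Q₀ i) := by
  let f : MvPolynomial (Fin (i + 1)) (ZMod p) →ₐ[ZMod p] AlgebraicClosure (ZMod p) :=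
    MvPolynomial.aeval fun k => a k
  have hf : ∀ x ∈ towerIdeal p Q₀ i, f x = 0 := by
    intro x hx
    have hle : towerIdeal p Q₀ i ≤ RingHom.ker f := by
      refine Ideal.span_le.2 ?_
      rintro y (rfl | ⟨j, rfl⟩)
      · simp only [SetLike.mem_coe, RingHom.mem_ker]
        rw [← Polynomial.aeval_algHom_apply, MvPolynomial.aeval_X]
        exact ha.root
      · simp only [SetLike.mem_coe, RingHom.mem_ker]
        simp only [f, map_sub, map_pow, MvPolynomial.aeval_X, Fin.val_succ, Fin.val_castSucc]
        rw [ha.step j, sub_self]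
    exact hle hx
  exact (Ideal.Quotient.lift (towerIdeal p Q₀ i) f.toRingHom hf).domain_nontrivial

/-- This transfers the minimal polynomials to the quotient ring: a monic irreducible polynomial that
annihilates an element of a nontrivial algebra is its minimal polynomial, and the quotient need not
be known to be a field. -/
theorem IsTowerSeq.aeval_mk_minpoly (ha : IsTowerSeq p Q₀ a) (hQ : Irreducible Q₀)
    (htr : Algebra.trace (ZMod p) (AdjoinRoot Q₀) (AdjoinRoot.root Q₀) ≠ 0) (i : ℕ)
    (j : Fin (i + 1)) :
    aeval (Ideal.Quotient.mk (towerIdeal p Q₀ i) (MvPolynomial.X j))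
      (minpoly (ZMod p) (a j)) = 0 := by
  induction j using Fin.induction with
  | zero =>
    rw [Fin.val_zero, ← minpoly.eq_of_irreducible hQ ha.root, map_mul, towerIdeal_mk_insert,
      zero_mul]
  | succ j ih =>
    rw [Fin.val_succ, ha.minpoly_succ hQ htr, aeval_comp]
    simp only [map_sub, map_pow, aeval_X]
    rw [towerIdeal_mk_step]
    have hdvd : minpoly (ZMod p) (a j) ∣
        (minpoly (ZMod p) (a j ^ stepExponent p Q₀.natDegree j)).comp
          (X ^ stepExponent p Q₀.natDegree j) := by
      refine minpoly.dvd _ _ ?_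
      rw [aeval_comp, map_pow, aeval_X, minpoly.aeval]
    obtain ⟨c, hc⟩ := hdvd
    have h := congrArg (aeval (Ideal.Quotient.mk (towerIdeal p Q₀ i)
      (MvPolynomial.X j.castSucc))) hc
    rw [Fin.val_castSucc] at ih
    rw [aeval_comp, map_pow, aeval_X, map_mul, ih, zero_mul] at h
    exact h

theorem IsTowerSeq.towerMinpoly_eq (ha : IsTowerSeq p Q₀ a) (hQ : Irreducible Q₀)
    (htr : Algebra.trace (ZMod p) (AdjoinRoot Q₀) (AdjoinRoot.root Q₀) ≠ 0) (i : ℕ) :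
    towerMinpoly p Q₀ i = minpoly (ZMod p) (a i) := by
  have := ha.nontrivial_towerLevel i
  have hint : IsIntegral (ZMod p) (a i) := Algebra.IsIntegral.isIntegral _
  exact (minpoly.eq_of_irreducible_of_monic (minpoly.irreducible hint)
    (ha.aeval_mk_minpoly hQ htr i (Fin.last i)) (minpoly.monic hint)).symm

end Tower

/-! ### Products of twists by roots of unity -/

section Twist

open Function

/-- The product of the first `m` twists of `Q` by a root of unity. -/
noncomputable def twistProd {R K : Type*} [CommRing R] [CommRing K] [Algebra R K] (Q : R[X])
    (ζ : K) (m : ℕ) : K[X] :=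
  ∏ j ∈ Finset.range m, (Q.map (algebraMap R K)).comp (C (ζ ^ j) * X)

/-- The factors `ζ ^ j` multiply to `ζ ^ (e (e - 1) / 2)`, which is `1` for odd `e`. -/
theorem IsPrimitiveRoot.prod_C_mul_X_sub_C {K : Type*} [Field K] {ζ : K} {e : ℕ}
    (hζ : IsPrimitiveRoot ζ e) (he : Odd e) (b : K) :
    ∏ j ∈ Finset.range e, (C (ζ ^ j) * X - C b) = X ^ e - C (b ^ e) := by
  have h0 : ζ ≠ 0 := hζ.ne_zero he.pos.ne'
  have h1 : ∀ j, C (ζ ^ j) * X - C b = C (ζ ^ j) * (X - C (ζ⁻¹ ^ j * b)) := by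
    intro j
    rw [mul_sub, ← C_mul, ← mul_assoc, ← mul_pow, mul_inv_cancel₀ h0, one_pow, one_mul]
  have h2 : ∏ j ∈ Finset.range e, ζ ^ j = 1 := by
    obtain ⟨k, hk⟩ := he
    rw [Finset.prod_pow_eq_pow_sum, Finset.sum_range_id, show e * (e - 1) / 2 = e * k by
      rw [hk, Nat.add_sub_cancel]
      exact Nat.div_eq_of_eq_mul_left (by norm_num) (by ring), pow_mul, hζ.pow_eq_one, one_pow]
  simp only [h1]
  rw [Finset.prod_mul_distrib, ← map_prod, h2, C_1, one_mul,
    X_pow_sub_C_eq_prod hζ.inv he.pos rfl]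

variable {p : ℕ} [Fact p.Prime]

theorem two_mul_sub_one_cast_ne_zero (K : Type*) [Field K] [CharP K p] :
    ((2 * p - 1 : ℕ) : K) ≠ 0 := by
  have hp := (Fact.out : p.Prime)
  rw [Nat.cast_sub (by have := hp.one_le; omega)]
  simp

/-- Both sides are products over the same number `n` of conjugates, which can be compared one by
one; this is where the equality of the two periods enters. -/
theorem twistProd_minpoly {K : Type*} [Field K] [CharP K p] [Algebra (ZMod p) K] {x : K} {n e : ℕ}
    (hx : minimalPeriod (frobenius K p) x = n)
    (hxe : minimalPeriod (frobenius K p) (x ^ e) = n) (hn0 : n ≠ 0) (he : Odd e) {ζ : K}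
    (hζ : IsPrimitiveRoot ζ e) :
    twistProd (minpoly (ZMod p) x) ζ e =
      ((minpoly (ZMod p) (x ^ e)).comp (X ^ e)).map (algebraMap (ZMod p) K) := by
  rw [Polynomial.map_comp, minpoly_map_eq_prod hxe hn0, twistProd, minpoly_map_eq_prod hx hn0,
    Polynomial.prod_comp]
  simp only [Polynomial.prod_comp, sub_comp, X_comp, C_comp, Polynomial.map_pow, map_X]
  rw [Finset.prod_comm]
  refine Finset.prod_congr rfl fun k _ => ?_
  rw [hζ.prod_C_mul_X_sub_C he, iterate_map_pow]

theorem exists_isPrimitiveRoot (K : Type*) [Field K] [IsAlgClosed K] (n : ℕ) [NeZero (n : K)] :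
    ∃ ζ : K, IsPrimitiveRoot ζ n := by
  obtain ⟨ζ, hζ⟩ := IsAlgClosed.exists_root (cyclotomic n K)
    (degree_cyclotomic_pos n K (NeZero.pos_of_neZero_natCast K)).ne'
  exact ⟨ζ, isRoot_cyclotomic_iff.1 hζ⟩

/-- As `2 p - 1 = -1` in `𝔽_p`, the cyclotomic polynomial splits over `K` into distinct linear
factors; a polynomial that vanishes at all primitive roots is divisible by it, whether or not it is
irreducible over `𝔽_p`. -/
theorem eq_of_forall_primitiveRoot {K : Type*} [Field K] [IsAlgClosed K] [CharP K p]
    [Algebra (ZMod p) K] {f g : (CycloRing p)[X]}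
    (h : ∀ φ : CycloRing p →ₐ[ZMod p] K,
      IsPrimitiveRoot (φ (AdjoinRoot.root _)) (2 * p - 1) →
      f.map (φ : CycloRing p →+* K) = g.map (φ : CycloRing p →+* K)) : f = g := by
  have : NeZero ((2 * p - 1 : ℕ) : ZMod p) := ⟨two_mul_sub_one_cast_ne_zero _⟩
  have : NeZero ((2 * p - 1 : ℕ) : K) := ⟨two_mul_sub_one_cast_ne_zero (p := p) _⟩
  ext k
  rw [← sub_eq_zero, ← coeff_sub]
  obtain ⟨c, hc⟩ := AdjoinRoot.mk_surjective ((f - g).coeff k)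
  rw [← hc, AdjoinRoot.mk_eq_zero]
  obtain ⟨ζ, hζ⟩ := exists_isPrimitiveRoot K (2 * p - 1)
  rw [← map_dvd_map' (algebraMap (ZMod p) K), map_cyclotomic,
    cyclotomic_eq_prod_X_sub_primitiveRoots hζ]
  refine Finset.prod_dvd_of_coprime (fun μ _ ν _ hμν => ?_) fun μ hμ => ?_
  · exact isCoprime_X_sub_C_of_isUnit_sub (sub_ne_zero.2 hμν).isUnit
  · have hμ' := isPrimitiveRoot_of_mem_primitiveRoots hμ
    have hroot : (cyclotomic (2 * p - 1) (ZMod p)).eval₂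
        (Algebra.ofId (ZMod p) K : ZMod p →+* K) μ = 0 := by
      have := (isRoot_cyclotomic_iff (n := 2 * p - 1)).2 hμ'
      rw [← map_cyclotomic _ (algebraMap (ZMod p) K), IsRoot, eval_map] at this
      exact this
    have hφ := h (AdjoinRoot.liftAlgHom _ (Algebra.ofId (ZMod p) K) μ hroot)
      (by rw [AdjoinRoot.liftAlgHom_root]; exact hμ')
    have hφk := congrArg (fun P => P.coeff k) hφ
    simp only [coeff_map] at hφk
    have hc' := congrArg (AdjoinRoot.liftAlgHom _ (Algebra.ofId (ZMod p) K) μ hroot) hc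
    rw [AdjoinRoot.liftAlgHom_mk, coeff_sub, map_sub] at hc'
    rw [dvd_iff_isRoot, IsRoot, eval_map]
    exact hc'.trans (sub_eq_zero.2 hφk)

theorem starPoly_eq {Q q : (ZMod p)[X]} {K : Type*} [Field K] [IsAlgClosed K] [CharP K p]
    [Algebra (ZMod p) K]
    (h : ∀ ζ : K, IsPrimitiveRoot ζ (2 * p - 1) → twistProd Q ζ (2 * p - 1) =
      (q.comp (X ^ (2 * p - 1))).map (algebraMap (ZMod p) K)) :
    starPoly p Q = (q.comp (X ^ (2 * p - 1))).map (algebraMap (ZMod p) (CycloRing p)) := by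
  refine eq_of_forall_primitiveRoot (K := K) fun φ hφ => ?_
  have hcomp : (φ : CycloRing p →+* K).comp (algebraMap (ZMod p) (CycloRing p)) =
      algebraMap (ZMod p) K := φ.comp_algebraMap
  rw [Polynomial.map_map, hcomp, ← h _ hφ, starPoly, twistProd, Polynomial.map_prod]
  refine Finset.prod_congr rfl fun j _ => ?_
  rw [Polynomial.map_comp, Polynomial.map_map, hcomp]
  simp

end Twist

/-! ### The substitution of `Y ^ p - Y` -/

section Subst

variable {p : ℕ} [Fact p.Prime]

/-- Subtract from `f` the terms of exponent `t` with `c t`, divided by `Y ^ δ`. -/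
noncomputable def lowerTerms (F : Type*) [CommRing F] (c : ℕ → Prop) [DecidablePred c] (δ : ℕ) :
    F[X] →ₗ[F] F[X] :=
  lsum fun t => monomial t - if c t then monomial (t - δ) else 0

section

variable {F : Type*} [CommRing F] {c : ℕ → Prop} [DecidablePred c] {δ : ℕ}

theorem coeff_lowerTerms (hc : ∀ t, c t → δ ≤ t) (f : F[X]) (t : ℕ) :
    (lowerTerms F c δ f).coeff t = f.coeff t - if c (t + δ) then f.coeff (t + δ) else 0 := by
  induction f using Polynomial.induction_on' with
  | add f g hf hg => rw [map_add, coeff_add, hf, hg, coeff_add, coeff_add]; split_ifs <;> ring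
  | monomial s a =>
    have h : lowerTerms F c δ (monomial s a) =
        monomial s a - if c s then monomial (s - δ) a else 0 := by
      rw [lowerTerms, lsum_apply, sum_monomial_index]
      · split_ifs <;> simp
      · simp
    rw [h, coeff_sub, coeff_monomial, coeff_monomial]
    congr 1
    by_cases hst : s = t + δ
    · subst hst
      by_cases h1 : c (t + δ) <;> simp [h1]
    · split_ifs with h1
      · rw [coeff_monomial, if_neg (by have := hc s h1; omega)]
      · rw [coeff_monomial, if_neg (by have := hc s h1; omega)]
      all_goals simp

theorem lowerTerms_eq_self (hc : ∀ t, c t → δ ≤ t) {f : F[X]}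
    (h : ∀ t, c t → f.coeff t = 0) : lowerTerms F c δ f = f := by
  ext t
  rw [coeff_lowerTerms hc]
  split_ifs with h1
  · rw [h _ h1, sub_zero]
  · rw [sub_zero]

/-- All exponents that occur satisfy `c`, so the whole polynomial is shifted down by `δ` and
subtracted. -/
theorem lowerTerms_X_pow_mul (hc : ∀ t, c t → δ ≤ t) {m : ℕ} {f : F[X]}
    (h : ∀ t, ¬ c (t + δ) → (X ^ m * f).coeff t = 0) :
    lowerTerms F c δ (X ^ (δ + m) * f) = X ^ (δ + m) * f - X ^ m * f := by
  ext t
  rw [coeff_lowerTerms hc, coeff_sub, pow_add, mul_assoc, coeff_X_pow_mul (n := δ)]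
  split_ifs with h1
  · rfl
  · rw [h _ h1]

end

/-- The condition for the terms that are changed in step `r` of level `k`. -/
def highDigit (p k r t : ℕ) : Prop := r * p ^ (k + 1) ≤ t % p ^ (k + 2)

instance (p k r : ℕ) : DecidablePred (highDigit p k r) := fun _ => Nat.decLe _ _

/-- The linear map that `substProg` carries out. -/
noncomputable def substMap (p k r : ℕ) : (ZMod p)[X] →ₗ[ZMod p] (ZMod p)[X] :=
  lowerTerms (ZMod p) (highDigit p k r) (p ^ (k + 1) - p ^ k)

theorem le_of_highDigit {p k r t : ℕ} (hr : r ≠ 0) (h : highDigit p k r t) :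
    p ^ (k + 1) - p ^ k ≤ t :=
  calc p ^ (k + 1) - p ^ k ≤ 1 * p ^ (k + 1) := by omega
    _ ≤ r * p ^ (k + 1) := Nat.mul_le_mul_right _ (Nat.one_le_iff_ne_zero.2 hr)
    _ ≤ t % p ^ (k + 2) := h
    _ ≤ t := Nat.mod_le _ _

theorem SLProgram.output_substProg {n k r : ℕ} (hr : r ≠ 0) {f : (ZMod p)[X]}
    (hf : f.natDegree ≤ p * n) :
    (SLProgram.substProg p n k r).output (coeffsBelow f (p * n + 1)) =
      coeffsBelow (substMap p k r f) (p * n + 1) := by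
  rw [substProg, output_parLayer _ (by simp [coeffsBelow]), List.map_map, coeffsBelow]
  refine List.map_congr_left fun t ht => ?_
  rw [List.mem_range] at ht
  rw [substMap, coeff_lowerTerms fun t => le_of_highDigit hr]
  simp only [Function.comp, Instr.eval, getD_map_range, if_pos ht]
  congr 1
  by_cases h1 : r * p ^ (k + 1) ≤ (t + (p ^ (k + 1) - p ^ k)) % p ^ (k + 2)
  · have h1' : highDigit p k r (t + (p ^ (k + 1) - p ^ k)) := h1
    rw [if_pos h1, if_pos h1']
    split_ifs
    · rfl
    · exact (coeff_eq_zero_of_natDegree_lt (by omega)).symm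
  · have h1' : ¬ highDigit p k r (t + (p ^ (k + 1) - p ^ k)) := h1
    rw [if_neg h1, if_neg h1', if_neg (lt_irrefl _)]

theorem natDegree_substMap_le {k r : ℕ} (hr : r ≠ 0) {f : (ZMod p)[X]} {N : ℕ}
    (hf : f.natDegree ≤ N) : (substMap p k r f).natDegree ≤ N := by
  refine natDegree_le_iff_coeff_eq_zero.2 fun t ht => ?_
  rw [substMap, coeff_lowerTerms fun t => le_of_highDigit hr,
    coeff_eq_zero_of_natDegree_lt (by omega), coeff_eq_zero_of_natDegree_lt (by omega)]
  simp

/-- The first `s` steps of level `k`. -/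
noncomputable def levelMap (p k : ℕ) : ℕ → (ZMod p)[X] →ₗ[ZMod p] (ZMod p)[X]
  | 0 => LinearMap.id
  | s + 1 => substMap p k (p - 1 - s) ∘ₗ levelMap p k s

/-- The first `k` levels. -/
noncomputable def levelsMap (p : ℕ) : ℕ → (ZMod p)[X] →ₗ[ZMod p] (ZMod p)[X]
  | 0 => LinearMap.id
  | k + 1 => levelMap p k (p - 1) ∘ₗ levelsMap p k

theorem SLProgram.foldl_level {n k : ℕ} {f : (ZMod p)[X]} (hf : f.natDegree ≤ p * n) {s : ℕ}
    (hs : s ≤ p - 1) :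
    (levelMap p k s f).natDegree ≤ p * n ∧
    ((List.range s).map fun s => SLProgram.substProg p n k (p - 1 - s)).foldl
      (fun y P => P.output y) (coeffsBelow f (p * n + 1)) =
      coeffsBelow (levelMap p k s f) (p * n + 1) := by
  induction s with
  | zero =>
    simp only [levelMap, LinearMap.id_apply, List.range_zero, List.map_nil, List.foldl_nil]
    exact ⟨hf, trivial⟩
  | succ s ih =>
    obtain ⟨h1, h2⟩ := ih (by omega)
    rw [levelMap, LinearMap.comp_apply]
    refine ⟨natDegree_substMap_le (by omega) h1, ?_⟩
    rw [List.range_succ, List.map_append, List.foldl_append, h2]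
    exact SLProgram.output_substProg (by omega) h1

theorem SLProgram.foldl_levels {n : ℕ} {f : (ZMod p)[X]} (hf : f.natDegree ≤ p * n) (k : ℕ) :
    (levelsMap p k f).natDegree ≤ p * n ∧
    ((List.range k).flatMap fun k =>
      (List.range (p - 1)).map fun s => SLProgram.substProg p n k (p - 1 - s)).foldl
      (fun y P => P.output y) (coeffsBelow f (p * n + 1)) =
      coeffsBelow (levelsMap p k f) (p * n + 1) := by
  induction k with
  | zero =>
    simp only [levelsMap, LinearMap.id_apply, List.range_zero, List.flatMap_nil, List.foldl_nil]
    exact ⟨hf, trivial⟩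
  | succ k ih =>
    obtain ⟨h1, h2⟩ := ih
    have h3 := SLProgram.foldl_level (k := k) h1 le_rfl
    rw [levelsMap, LinearMap.comp_apply]
    refine ⟨h3.1, ?_⟩
    rw [List.range_succ, List.flatMap_append, List.foldl_append, h2, List.flatMap_singleton]
    exact h3.2

/-- After `s` passes the digit `d` is cut down to at most `p - 1 - s`, and each unit removed has
become a factor `X ^ p ^ (k + 1) - X ^ p ^ k`. The bound on `B` prevents carries between digits. -/
theorem levelMap_apply {k g d s : ℕ} (hd : d < p) (hs : s ≤ p - 1) {B : (ZMod p)[X]}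
    (hB : B.natDegree < p ^ (k + 1)) :
    levelMap p k s (X ^ (g * p ^ (k + 2) + d * p ^ (k + 1)) * B) =
      X ^ (g * p ^ (k + 2) + min d (p - 1 - s) * p ^ (k + 1)) *
        ((X ^ p ^ (k + 1) - X ^ p ^ k) ^ (d - (p - 1 - s)) * B) := by
  have hp := (Fact.out : p.Prime)
  induction s with
  | zero =>
    rw [show min d (p - 1 - 0) = d by omega, show d - (p - 1 - 0) = 0 by omega, pow_zero, one_mul]
    rfl
  | succ s ih =>
    rw [levelMap, LinearMap.comp_apply, ih (by omega)]
    set r := p - 1 - s with hr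
    have hr' : p - 1 - (s + 1) = r - 1 := by omega
    have hr0 : r ≠ 0 := by omega
    have hP : p ^ (k + 2) = p * p ^ (k + 1) := by ring
    have hPk : p ^ k ≤ p ^ (k + 1) := Nat.pow_le_pow_right hp.pos (by omega)
    rw [hr']
    rcases lt_or_ge d r with hdr | hdr
    -- The digit of every exponent is below `r`, so this pass changes nothing.
    · rw [show min d r = d by omega, show min d (r - 1) = d by omega, show d - r = 0 by omega,
        show d - (r - 1) = 0 by omega, pow_zero, one_mul]
      refine lowerTerms_eq_self (fun t => le_of_highDigit hr0) fun t ht => ?_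
      rw [coeff_X_pow_mul']
      split_ifs with h1
      · refine coeff_eq_zero_of_natDegree_lt (hB.trans_le ?_)
        by_contra hlt
        push Not at hlt
        obtain ⟨u, rfl⟩ := Nat.exists_eq_add_of_le h1
        rw [Nat.add_sub_cancel_left] at hlt
        have h2 : d * p ^ (k + 1) + u < (d + 1) * p ^ (k + 1) := by rw [add_mul, one_mul]; omega
        have h3 : (d + 1) * p ^ (k + 1) ≤ r * p ^ (k + 1) := Nat.mul_le_mul_right _ hdr
        have h4 : r * p ^ (k + 1) ≤ p ^ (k + 2) := by
          rw [hP]; exact Nat.mul_le_mul_right _ (by omega)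
        rw [highDigit, add_assoc, add_comm (g * _), Nat.add_mul_mod_self_right,
          Nat.mod_eq_of_lt (by omega)] at ht
        omega
      · rfl
    · rw [show min d r = r by omega, show min d (r - 1) = r - 1 by omega]
      have h1 : g * p ^ (k + 2) + r * p ^ (k + 1) =
          (p ^ (k + 1) - p ^ k) + (g * p ^ (k + 2) + (r - 1) * p ^ (k + 1) + p ^ k) := by
        obtain ⟨r', hr''⟩ := Nat.exists_eq_succ_of_ne_zero hr0
        rw [hr'', Nat.succ_eq_add_one, Nat.add_sub_cancel, add_mul, one_mul]
        omega
      rw [h1, substMap, lowerTerms_X_pow_mul fun t => le_of_highDigit hr0]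
      · have h2 : d - (r - 1) = (d - r) + 1 := by omega
        rw [← h1, h2, show g * p ^ (k + 2) + r * p ^ (k + 1) =
          g * p ^ (k + 2) + (r - 1) * p ^ (k + 1) + p ^ (k + 1) by omega, pow_succ]
        ring
      · intro t ht
        rw [coeff_X_pow_mul']
        split_ifs with h2
        · refine coeff_eq_zero_of_natDegree_lt ?_
          by_contra hle
          push Not at hle
          refine ht ?_
          obtain ⟨u, rfl⟩ := Nat.exists_eq_add_of_le h2
          rw [Nat.add_sub_cancel_left] at hle
          have h3 : ((X ^ p ^ (k + 1) - X ^ p ^ k : (ZMod p)[X]) ^ (d - r) * B).natDegree ≤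
              (d - r) * p ^ (k + 1) + B.natDegree := by
            refine natDegree_mul_le.trans (Nat.add_le_add_right (natDegree_pow_le.trans
              (Nat.mul_le_mul_left _ ?_)) _)
            refine (natDegree_sub_le _ _).trans ?_
            rw [natDegree_X_pow, natDegree_X_pow]
            exact max_le le_rfl hPk
          have h4 : g * p ^ (k + 2) + (r - 1) * p ^ (k + 1) + p ^ k + u +
              (p ^ (k + 1) - p ^ k) = (r * p ^ (k + 1) + u) + g * p ^ (k + 2) := by omega
          have h5 : r * p ^ (k + 1) + (d - r) * p ^ (k + 1) = d * p ^ (k + 1) := by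
            rw [← add_mul]; congr 1; omega
          -- Modulo `p ^ (k + 2)` all exponents stay between `r p ^ (k + 1)` and `(d + 1) p ^ (k +
          -- 1)`, so every term is rewritten.
          have h6 : (d + 1) * p ^ (k + 1) ≤ p ^ (k + 2) := by
            rw [hP]; exact Nat.mul_le_mul_right _ hd
          rw [add_mul, one_mul] at h6
          rw [highDigit, h4, Nat.add_mul_mod_self_right, Nat.mod_eq_of_lt (by omega)]
          omega
        · rfl

/-- The `k` lowest digits of `j` have been processed, and the higher ones still stand for powers of
`X ^ p ^ (k + 1)`. -/
theorem levelsMap_X_pow (k j : ℕ) :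
    levelsMap p k (X ^ (p * j)) =
      X ^ (p ^ (k + 1) * (j / p ^ k)) * (X ^ p - X) ^ (j % p ^ k) := by
  have hp := (Fact.out : p.Prime)
  induction k with
  | zero => simp [levelsMap, Nat.mod_one]
  | succ k ih =>
    have h1 : p ^ (k + 1) * (j / p ^ k) =
        j / p ^ (k + 1) * p ^ (k + 2) + (j / p ^ k % p) * p ^ (k + 1) := by
      conv_lhs => rw [← Nat.div_add_mod (j / p ^ k) p, Nat.div_div_eq_div_mul, ← pow_succ]
      ring
    have hW : (X ^ p ^ (k + 1) - X ^ p ^ k : (ZMod p)[X]) = (X ^ p - X) ^ p ^ k := by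
      rw [sub_pow_char_pow, ← pow_mul, ← pow_succ']
    rw [levelsMap, LinearMap.comp_apply, ih, h1, levelMap_apply (Nat.mod_lt _ hp.pos) le_rfl,
      Nat.sub_self, Nat.min_zero, zero_mul, add_zero, Nat.sub_zero, Nat.mod_pow_succ, hW, ← pow_mul,
      ← pow_add, mul_comm (j / p ^ (k + 1)), add_comm (j % p ^ k)]
    · rw [natDegree_pow, FiniteField.X_pow_card_sub_X_natDegree_eq _ hp.one_lt, pow_succ]
      exact Nat.mul_lt_mul_of_pos_right (Nat.mod_lt _ (pow_pos hp.pos k)) hp.pos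

theorem levelsMap_expand {n k : ℕ} (hk : n < p ^ k) {q : (ZMod p)[X]} (hq : q.natDegree ≤ n) :
    levelsMap p k (expand (ZMod p) p q) = q.comp (X ^ p - X) := by
  have h : ∀ j ∈ Finset.range (n + 1), levelsMap p k (monomial (j * p) (q.coeff j)) =
      C (q.coeff j) * (X ^ p - X) ^ j := by
    intro j hj
    rw [Finset.mem_range] at hj
    rw [← C_mul_X_pow_eq_monomial, ← smul_eq_C_mul, map_smul, mul_comm, levelsMap_X_pow,
      Nat.div_eq_of_lt (by omega), Nat.mod_eq_of_lt (by omega), mul_zero, pow_zero, one_mul,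
      smul_eq_C_mul]
  conv_lhs => rw [q.as_sum_range' (n + 1) (by omega)]
  rw [map_sum, map_sum, comp_eq_sum_left, sum_over_range' _ (by simp) (n + 1) (by omega)]
  refine Finset.sum_congr rfl fun j hj => ?_
  rw [expand_monomial, h j hj]

theorem SLProgram.foldl_substSteps {n : ℕ} {q : (ZMod p)[X]} (hq : q.natDegree ≤ n) :
    (SLProgram.substSteps p n).foldl (fun y P => P.output y) (coeffsBelow q (n + 1)) =
      coeffsBelow (q.comp (X ^ p - X)) (p * n + 1) := by
  have hp := (Fact.out : p.Prime)
  have h0 : SLProgram.output ([], (List.range (p * n + 1)).map fun t =>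
      if t % p = 0 then t / p else n + 1) (coeffsBelow q (n + 1)) =
      coeffsBelow (expand (ZMod p) p q) (p * n + 1) := by
    rw [output_select, List.map_map, coeffsBelow, coeffsBelow]
    refine List.map_congr_left fun t _ => ?_
    simp only [Function.comp, getD_map_range]
    rw [coeff_expand hp.pos]
    simp only [Nat.dvd_iff_mod_eq_zero]
    split_ifs
    · rfl
    · exact (coeff_eq_zero_of_natDegree_lt (by omega)).symm
    · omega
    · rfl
  rw [substSteps, List.foldl_cons, h0, (foldl_levels _ _).2,
    levelsMap_expand (Nat.lt_pow_succ_log_self hp.one_lt n) hq]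
  rw [natDegree_expand, mul_comm]
  exact Nat.mul_le_mul_left _ hq

end Subst

/-! ### Products of twists by programs -/

section Kronecker

variable {F : Type*} [CommRing F]

/-- Blocks of length `N` do not overlap, so Kronecker substitution loses nothing. -/
theorem coeff_eval_X_pow {N : ℕ} {G : F[X][X]} (hG : ∀ k, (G.coeff k).natDegree < N) {k r : ℕ}
    (hr : r < N) : (G.eval (X ^ N)).coeff (N * k + r) = (G.coeff k).coeff r := by
  rw [eval_eq_sum_range' (n := max G.natDegree k + 1) (by omega), finsetSum_coeff,
    Finset.sum_eq_single k]
  · rw [← pow_mul, coeff_mul_X_pow', if_pos (by omega), Nat.add_sub_cancel_left]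
  · intro j _ hj
    rw [← pow_mul, coeff_mul_X_pow']
    split_ifs with h
    · refine coeff_eq_zero_of_natDegree_lt ((hG j).trans_le ?_)
      have hjk : j < k := by
        by_contra hlt
        have h1 : N * (k + 1) ≤ N * j := Nat.mul_le_mul_left _ (by omega)
        rw [Nat.mul_succ] at h1
        omega
      have h1 : N * (j + 1) ≤ N * k := Nat.mul_le_mul_left _ hjk
      rw [Nat.mul_succ] at h1
      omega
    · rfl
  · intro h
    exact absurd (Finset.mem_range.2 (by omega)) h

/-- The polynomial with coefficients `b 0, …, b (e - 1)`. -/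
noncomputable def rowPoly (e : ℕ) (b : ℕ → F) : F[X] := ∑ r ∈ Finset.range e, monomial r (b r)

theorem coeff_rowPoly (e : ℕ) (b : ℕ → F) (r : ℕ) :
    (rowPoly e b).coeff r = if r < e then b r else 0 := by
  simp [rowPoly, coeff_monomial]

theorem natDegree_rowPoly {e : ℕ} (he : 0 < e) (b : ℕ → F) : (rowPoly e b).natDegree < e := by
  have h : (rowPoly e b).natDegree ≤ e - 1 := by
    refine natDegree_le_iff_coeff_eq_zero.2 fun t ht => ?_
    rw [coeff_rowPoly, if_neg (by omega)]
  omega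

/-- The polynomial in two variables with coefficients `c k r` for `k < D` and `r < e`. -/
noncomputable def arrayPoly (e D : ℕ) (c : ℕ → ℕ → F) : F[X][X] :=
  rowPoly D fun k => rowPoly e (c k)

theorem coeff_arrayPoly (e D : ℕ) (c : ℕ → ℕ → F) (k : ℕ) :
    (arrayPoly e D c).coeff k = if k < D then rowPoly e (c k) else 0 := coeff_rowPoly _ _ _

theorem natDegree_coeff_arrayPoly {e : ℕ} (he : 0 < e) (D : ℕ) (c : ℕ → ℕ → F) (k : ℕ) :
    ((arrayPoly e D c).coeff k).natDegree < e := by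
  rw [coeff_arrayPoly]
  split_ifs
  · exact natDegree_rowPoly he _
  · simpa using he

theorem natDegree_coeff_arrayPoly_mul {e : ℕ} (he : 0 < e) (D : ℕ) (c g : ℕ → ℕ → F) (k : ℕ) :
    ((arrayPoly e D c * arrayPoly e D g).coeff k).natDegree < 2 * e := by
  have h : ((arrayPoly e D c * arrayPoly e D g).coeff k).natDegree ≤ 2 * e - 2 := by
    rw [coeff_mul]
    refine natDegree_sum_le_of_forall_le _ _ fun x _ => natDegree_mul_le.trans ?_
    have h1 := natDegree_coeff_arrayPoly he D c x.1
    have h2 := natDegree_coeff_arrayPoly he D g x.2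
    omega
  omega

/-- The polynomial in one variable whose blocks of length `2 e` are the rows of `c`. -/
noncomputable def packPoly (e D : ℕ) (c : ℕ → ℕ → F) : F[X] :=
  (arrayPoly e D c).eval (X ^ (2 * e))

theorem coeff_packPoly {e : ℕ} (he : 0 < e) (D : ℕ) (c : ℕ → ℕ → F) (s : ℕ) :
    (packPoly e D c).coeff s =
      if s / (2 * e) < D ∧ s % (2 * e) < e then c (s / (2 * e)) (s % (2 * e)) else 0 := by
  conv_lhs => rw [← Nat.div_add_mod s (2 * e)]
  rw [packPoly, coeff_eval_X_pow (fun k => (natDegree_coeff_arrayPoly he D c k).trans (by omega))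
    (Nat.mod_lt _ (by omega)), coeff_arrayPoly]
  by_cases h : s / (2 * e) < D
  · rw [if_pos h, coeff_rowPoly]
    simp only [h, true_and]
  · simp [h]

theorem degree_packPoly_lt {e : ℕ} (he : 0 < e) (D : ℕ) (c : ℕ → ℕ → F) :
    (packPoly e D c).degree < (2 * e * D : ℕ) := by
  rw [degree_lt_iff_coeff_zero]
  intro s hs
  rw [coeff_packPoly he, if_neg]
  rintro ⟨h, -⟩
  rw [Nat.div_lt_iff_lt_mul (by omega)] at h
  rw [mul_comm] at hs
  omega

/-- The array of the product, with the rows reduced modulo `X ^ e - 1`. -/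
noncomputable def arrayMul (e D : ℕ) (c g : ℕ → ℕ → F) (k r : ℕ) : F :=
  (packPoly e D c * packPoly e D g).coeff (2 * e * k + r) +
    (packPoly e D c * packPoly e D g).coeff (2 * e * k + (r + e))

theorem arrayMul_eq {e : ℕ} (he : 0 < e) (D : ℕ) (c g : ℕ → ℕ → F) (k : ℕ) {r : ℕ} (hr : r < e) :
    arrayMul e D c g k r = ((arrayPoly e D c * arrayPoly e D g).coeff k).coeff r +
      ((arrayPoly e D c * arrayPoly e D g).coeff k).coeff (r + e) := by
  rw [arrayMul, packPoly, packPoly, ← eval_mul,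
    coeff_eval_X_pow (natDegree_coeff_arrayPoly_mul he D c g) (by omega),
    coeff_eval_X_pow (natDegree_coeff_arrayPoly_mul he D c g) (by omega)]

variable {K : Type*} [CommRing K] [Algebra F K]

/-- The value of a row at a root of unity. -/
noncomputable def rowEval (e : ℕ) (ζ : K) (b : ℕ → F) : K :=
  ∑ r ∈ Finset.range e, algebraMap F K (b r) * ζ ^ r

/-- The polynomial in `Y` that an array represents at a root of unity. -/
noncomputable def arrayEval (e D : ℕ) (ζ : K) (c : ℕ → ℕ → F) : K[X] :=
  rowPoly D fun k => rowEval e ζ (c k)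

theorem aeval_rowPoly (e : ℕ) (ζ : K) (b : ℕ → F) : aeval ζ (rowPoly e b) = rowEval e ζ b := by
  simp [rowPoly, rowEval, aeval_monomial]

theorem arrayEval_eq_map (e D : ℕ) (ζ : K) (c : ℕ → ℕ → F) :
    arrayEval e D ζ c = (arrayPoly e D c).map (aeval ζ : F[X] →ₐ[F] K).toRingHom := by
  ext k
  rw [coeff_map, coeff_arrayPoly, arrayEval, coeff_rowPoly]
  split_ifs
  · exact (aeval_rowPoly e ζ (c k)).symm
  · simp

/-- Rows beyond `D` are dropped. They need not vanish, but their values at `ζ` do, by the degree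
bound. -/
theorem arrayEval_arrayMul {e D : ℕ} (he : 0 < e) {ζ : K} (hζ : ζ ^ e = 1) (c g : ℕ → ℕ → F)
    (hdeg : (arrayEval e D ζ c * arrayEval e D ζ g).natDegree < D) :
    arrayEval e D ζ (arrayMul e D c g) = arrayEval e D ζ c * arrayEval e D ζ g := by
  ext k
  conv_lhs => rw [arrayEval, coeff_rowPoly]
  split_ifs with hk
  · rw [arrayEval_eq_map, arrayEval_eq_map, ← Polynomial.map_mul, coeff_map]
    change _ = aeval ζ ((arrayPoly e D c * arrayPoly e D g).coeff k)
    rw [aeval_eq_sum_range' (natDegree_coeff_arrayPoly_mul he D c g k), two_mul,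
      Finset.sum_range_add, ← Finset.sum_add_distrib]
    refine Finset.sum_congr rfl fun r hr => ?_
    rw [arrayMul_eq he D c g k (Finset.mem_range.1 hr), map_add, pow_add, hζ, Algebra.smul_def,
      Algebra.smul_def, add_comm e r, one_mul, add_mul]
  · exact (coeff_eq_zero_of_natDegree_lt (by omega)).symm

theorem sum_range_add_mod {M : Type*} [AddCommGroup M] {e : ℕ} {f : ℕ → M}
    (hf : ∀ r, f (r + e) = f r) (a : ℕ) :
    ∑ r ∈ Finset.range e, f (r + a) = ∑ r ∈ Finset.range e, f r := by
  induction a with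
  | zero => rfl
  | succ a ih =>
    have h1 := Finset.sum_range_succ (fun r => f (r + a)) e
    have h2 := Finset.sum_range_succ' (fun r => f (r + a)) e
    rw [h1, ih] at h2
    rw [zero_add, add_comm e a, hf, add_left_inj] at h2
    rw [h2]
    exact Finset.sum_congr rfl fun r _ => by rw [add_assoc, add_comm 1 a]

/-- Since `a` is `-m` modulo `e`, the rotation is multiplication by `x ^ m` modulo `x ^ e - 1`. -/
theorem rowEval_rotate {e : ℕ} {ζ : K} (hζ : ζ ^ e = 1) {a m : ℕ} (ham : e ∣ a + m)
    (b : ℕ → F) : rowEval e ζ (fun r => b ((r + a) % e)) = ζ ^ m * rowEval e ζ b := by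
  have h1 : ∑ r ∈ Finset.range e, algebraMap F K (b ((r + a) % e)) * ζ ^ (r + a) =
      rowEval e ζ b := by
    rw [sum_range_add_mod (f := fun r => algebraMap F K (b (r % e)) * ζ ^ r)]
    · refine Finset.sum_congr rfl fun r hr => ?_
      rw [Nat.mod_eq_of_lt (Finset.mem_range.1 hr)]
    · intro r
      rw [Nat.add_mod_right, pow_add, hζ, mul_one]
  have h2 : ζ ^ (a + m) = 1 := by
    obtain ⟨s, hs⟩ := ham
    rw [hs, pow_mul, hζ, one_pow]
  rw [← h1, Finset.mul_sum, rowEval]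
  refine Finset.sum_congr rfl fun r _ => ?_
  linear_combination -(algebraMap F K (b ((r + a) % e)) * ζ ^ r) * h2

theorem arrayEval_twist {e D m : ℕ} (hm : m ≤ e) {ζ : K} (hζ : ζ ^ e = 1) (c : ℕ → ℕ → F) :
    arrayEval e D ζ (fun k r => c k ((r + (e - m) * k) % e)) =
      (arrayEval e D ζ c).comp (C (ζ ^ m) * X) := by
  ext k
  rw [comp_C_mul_X_coeff, arrayEval, arrayEval, coeff_rowPoly, coeff_rowPoly]
  split_ifs
  · rw [rowEval_rotate hζ (m := m * k) ⟨k, by rw [← add_mul, Nat.sub_add_cancel hm]⟩, ← pow_mul,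
      mul_comm]
  · rw [zero_mul]

theorem arrayEval_input {e n D m : ℕ} (he : 0 < e) (hn : n < D) {ζ : K} (hζ : ζ ^ e = 1)
    {Q : F[X]} (hQ : Q.natDegree ≤ n) :
    arrayEval e D ζ (fun k r => if k ≤ n ∧ r = m * k % e then Q.coeff k else 0) =
      (Q.map (algebraMap F K)).comp (C (ζ ^ m) * X) := by
  ext k
  rw [comp_C_mul_X_coeff, arrayEval, coeff_rowPoly, coeff_map]
  by_cases hk : k ≤ n
  · rw [if_pos (by omega), rowEval, Finset.sum_eq_single (m * k % e)]
    · rw [if_pos ⟨hk, rfl⟩, ← pow_mul]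
      conv_rhs => rw [← Nat.div_add_mod (m * k) e, pow_add, pow_mul, hζ, one_pow, one_mul]
    · intro r _ hr
      rw [if_neg (fun h => hr h.2), map_zero, zero_mul]
    · intro h
      exact absurd (Finset.mem_range.2 (Nat.mod_lt _ he)) h
  · rw [coeff_eq_zero_of_natDegree_lt (by omega : Q.natDegree < k), map_zero, zero_mul]
    split_ifs
    · simp [rowEval, hk]
    · rfl

theorem twistProd_two_mul (Q : F[X]) (ζ : K) (m : ℕ) :
    twistProd Q ζ (2 * m) = twistProd Q ζ m * (twistProd Q ζ m).comp (C (ζ ^ m) * X) := by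
  rw [twistProd, two_mul, Finset.prod_range_add, twistProd, Polynomial.prod_comp]
  congr 1
  refine Finset.prod_congr rfl fun j _ => ?_
  rw [comp_assoc, mul_comp, C_comp, X_comp, ← mul_assoc, ← C_mul, pow_add, mul_comm (ζ ^ m)]

theorem natDegree_twistProd_le {Q : F[X]} {n : ℕ} (hQ : Q.natDegree ≤ n) (ζ : K) (m : ℕ) :
    (twistProd Q ζ m).natDegree ≤ m * n := by
  refine (natDegree_prod_le _ _).trans ((Finset.sum_le_card_nsmul _ _ n fun j _ => ?_).trans
    (by simp))
  refine natDegree_comp_le.trans ((Nat.mul_le_mul natDegree_map_le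
    ((natDegree_C_mul_le _ _).trans natDegree_X_le)).trans (by omega))

end Kronecker

namespace SLProgram

section Star

variable {F : Type*} [CommRing F]

/-- The coefficients of `Q`, followed by an array. -/
def starState (e n : ℕ) (Q : F[X]) (c : ℕ → ℕ → F) : List F :=
  coeffsBelow Q (n + 1) ++ (List.range ((e * n + 1) * e)).map fun t => c (t / e) (t % e)

theorem length_coeffsBelow (Q : F[X]) (n : ℕ) : (coeffsBelow Q n).length = n := by
  simp [coeffsBelow]

theorem length_starState (e n : ℕ) (Q : F[X]) (c : ℕ → ℕ → F) :
    (starState e n Q c).length = n + 1 + (e * n + 1) * e := by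
  simp [starState, coeffsBelow]

theorem getD_coeffsBelow (Q : F[X]) (n k : ℕ) :
    (coeffsBelow Q n).getD k 0 = if k < n then Q.coeff k else 0 := getD_map_range _ _ _ _

theorem getD_append_add {α : Type*} {w : List α} {m : ℕ} (hw : w.length = m) (x : List α) (k : ℕ)
    (a : α) : (w ++ x).getD (m + k) a = x.getD k a := by
  subst hw
  exact List.getD_append_offset _ _ _ _

variable {e n : ℕ} {Q : F[X]} {c : ℕ → ℕ → F}

theorem getD_starState_left {k : ℕ} (hk : k ≤ n) : (starState e n Q c).getD k 0 = Q.coeff k := by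
  rw [starState, List.getD_append _ _ _ k (by rw [length_coeffsBelow]; omega), getD_coeffsBelow,
    if_pos (by omega)]

theorem mul_add_lt_of_lt {k r D : ℕ} (hk : k < D) (hr : r < e) : k * e + r < D * e :=
  calc k * e + r < (k + 1) * e := by rw [add_mul, one_mul]; omega
    _ ≤ D * e := Nat.mul_le_mul_right _ hk

theorem getD_starState_right {k r : ℕ} (hk : k < e * n + 1) (hr : r < e) :
    (starState e n Q c).getD (n + 1 + (k * e + r)) 0 = c k r := by
  rw [starState, getD_append_add (length_coeffsBelow Q (n + 1)), getD_map_range,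
    if_pos (mul_add_lt_of_lt hk hr), mul_comm k e, Nat.mul_add_div (by omega),
    Nat.div_eq_of_lt hr, add_zero, Nat.mul_add_mod, Nat.mod_eq_of_lt hr]

theorem getD_starState_default :
    (starState e n Q c).getD (n + 1 + (e * n + 1) * e) 0 = 0 :=
  List.getD_eq_default _ _ (by rw [length_starState])

theorem output_packProg (he : 0 < e) {g : ℕ → ℕ → F} {pos : ℕ → ℕ → ℕ}
    (hpos : ∀ k < e * n + 1, ∀ r < e, (starState e n Q c).getD (pos k r) 0 = g k r) :
    (packProg e n pos).output (starState e n Q c) =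
      coeffsBelow Q (n + 1) ++
        (coeffsBelow (packPoly e (e * n + 1) c) (2 * e * (e * n + 1)) ++
          coeffsBelow (packPoly e (e * n + 1) g) (2 * e * (e * n + 1))) := by
  rw [packProg, output_select, List.append_assoc, List.map_append, List.map_append, List.map_map,
    List.map_map]
  have hdiv : ∀ s ∈ List.range (2 * e * (e * n + 1)), s / (2 * e) < e * n + 1 := by
    intro s hs
    rw [Nat.div_lt_iff_lt_mul (by omega), mul_comm]
    exact List.mem_range.1 hs
  congr 1
  · exact List.map_congr_left fun k hk =>
      getD_starState_left (by have := List.mem_range.1 hk; omega)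
  congr 1
  · refine List.map_congr_left fun s hs => ?_
    rw [coeff_packPoly he]
    simp only [Function.comp, hdiv s hs, true_and]
    split_ifs with h
    · exact getD_starState_right (hdiv s hs) h
    · exact getD_starState_default
  · refine List.map_congr_left fun s hs => ?_
    rw [coeff_packPoly he]
    simp only [Function.comp, hdiv s hs, true_and]
    split_ifs with h
    · exact hpos _ (hdiv s hs) _ h
    · exact getD_starState_default

theorem output_foldProg (he : 0 < e) (g : ℕ → ℕ → F) :
    (foldProg e n).output (coeffsBelow Q (n + 1) ++
      coeffsBelow (packPoly e (e * n + 1) c * packPoly e (e * n + 1) g)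
        (2 * (2 * e * (e * n + 1)) - 1)) =
      starState e n Q (arrayMul e (e * n + 1) c g) := by
  rw [foldProg, output_parLayer _ (by simp [coeffsBelow]), List.map_append, List.map_map,
    List.map_map, starState]
  congr 1
  · refine List.map_congr_left fun k hk => ?_
    rw [List.mem_range] at hk
    simp only [Function.comp, Instr.eval]
    rw [List.getD_append _ _ _ k (by rw [length_coeffsBelow]; omega), getD_coeffsBelow,
      if_pos hk, List.getD_eq_default _ _ (by simp [coeffsBelow]), add_zero]
  · refine List.map_congr_left fun t ht => ?_
    rw [List.mem_range] at ht
    have h1 : t / e < e * n + 1 := by rwa [Nat.div_lt_iff_lt_mul he]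
    have h2 : t % e < e := Nat.mod_lt _ he
    have h3 : 2 * e * (t / e + 1) ≤ 2 * e * (e * n + 1) := Nat.mul_le_mul_left _ h1
    rw [Nat.mul_succ] at h3
    simp only [Function.comp, Instr.eval]
    rw [getD_append_add (length_coeffsBelow Q (n + 1)),
      getD_append_add (length_coeffsBelow Q (n + 1)), getD_coeffsBelow, getD_coeffsBelow,
      if_pos (by omega), if_pos (by omega), arrayMul]

/-- `P` computes the product of polynomials of degree less than `N`. -/
def Multiplies (F : Type*) [CommRing F] (P : SLProgram) (N : ℕ) : Prop :=
  ∀ f g : F[X], f.degree < N → g.degree < N →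
    P.output (coeffsBelow f N ++ coeffsBelow g N) = coeffsBelow (f * g) (2 * N - 1)

theorem foldl_mulSteps (he : 0 < e) {P : SLProgram} (hP : Multiplies F P (2 * e * (e * n + 1)))
    {g : ℕ → ℕ → F} {pos : ℕ → ℕ → ℕ}
    (hpos : ∀ k < e * n + 1, ∀ r < e, (starState e n Q c).getD (pos k r) 0 = g k r) :
    (mulSteps e n P pos).foldl (fun y P => P.output y) (starState e n Q c) =
      starState e n Q (arrayMul e (e * n + 1) c g) := by
  simp only [mulSteps, List.foldl_cons, List.foldl_nil]
  rw [output_packProg he hpos, output_keep _ (length_coeffsBelow Q (n + 1)),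
    hP _ _ (degree_packPoly_lt he _ _) (degree_packPoly_lt he _ _), output_foldProg he]

variable (K : Type*) [CommRing K] [Algebra F K]

/-- The array represents the product of the first `m` twists of `Q`. -/
def Represents (e n : ℕ) (Q : F[X]) (c : ℕ → ℕ → F) (m : ℕ) : Prop :=
  ∀ ζ : K, ζ ^ e = 1 → arrayEval e (e * n + 1) ζ c = twistProd Q ζ m

variable {K}

/-- The condition `2 m ≤ e` keeps the degree of the product at most `e n`, within the rows of the
array. -/
theorem Represents.mulSteps_twist (he : 0 < e) {P : SLProgram}
    (hP : Multiplies F P (2 * e * (e * n + 1))) (hQ : Q.natDegree ≤ n) {m : ℕ} (hm : 2 * m ≤ e)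
    (hc : Represents K e n Q c m) : ∃ c', Represents K e n Q c' (2 * m) ∧
      (mulSteps e n P (twistPos e n m)).foldl (fun y P => P.output y) (starState e n Q c) =
        starState e n Q c' := by
  refine ⟨_, fun ζ hζ => ?_, foldl_mulSteps he hP
    (g := fun k r => c k ((r + (e - m) * k) % e)) fun k hk r _ =>
      getD_starState_right hk (Nat.mod_lt _ he)⟩
  rw [arrayEval_arrayMul he hζ, arrayEval_twist (by omega) hζ, hc ζ hζ, ← twistProd_two_mul]
  rw [arrayEval_twist (by omega) hζ, hc ζ hζ, ← twistProd_two_mul]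
  exact Nat.lt_succ_of_le ((natDegree_twistProd_le hQ ζ _).trans (Nat.mul_le_mul_right _ hm))

theorem Represents.mulSteps_input (he : 0 < e) {P : SLProgram}
    (hP : Multiplies F P (2 * e * (e * n + 1))) (hQ : Q.natDegree ≤ n) {m : ℕ} (hm : m + 1 ≤ e)
    (hc : Represents K e n Q c m) : ∃ c', Represents K e n Q c' (m + 1) ∧
      (mulSteps e n P (inputPos e n m)).foldl (fun y P => P.output y) (starState e n Q c) =
        starState e n Q c' := by
  have hn : n < e * n + 1 := Nat.lt_succ_of_le (Nat.le_mul_of_pos_left n he)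
  have hsucc : ∀ ζ : K, twistProd Q ζ (m + 1) =
      twistProd Q ζ m * (Q.map (algebraMap F K)).comp (C (ζ ^ m) * X) :=
    fun ζ => Finset.prod_range_succ _ _
  refine ⟨_, fun ζ hζ => ?_, foldl_mulSteps he hP
    (g := fun k r => if k ≤ n ∧ r = m * k % e then Q.coeff k else 0) fun k hk r _ => ?_⟩
  · rw [arrayEval_arrayMul he hζ, arrayEval_input he hn hζ hQ, hc ζ hζ, ← hsucc]
    rw [arrayEval_input he hn hζ hQ, hc ζ hζ, ← hsucc]
    exact Nat.lt_succ_of_le ((natDegree_twistProd_le hQ ζ _).trans (Nat.mul_le_mul_right _ hm))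
  · rw [inputPos]
    split_ifs with h
    · exact getD_starState_left h.1
    · exact getD_starState_default

theorem Represents.doubleSteps (he : 0 < e) {P : SLProgram}
    (hP : Multiplies F P (2 * e * (e * n + 1))) (hQ : Q.natDegree ≤ n) {h : ℕ} (hh : h ≤ e)
    (hc : Represents K e n Q c (h / 2)) : ∃ c', Represents K e n Q c' h ∧
      (doubleSteps e n P h).foldl (fun y P => P.output y) (starState e n Q c) =
        starState e n Q c' := by
  obtain ⟨c₁, h1, h2⟩ := hc.mulSteps_twist he hP hQ (by omega)
  rw [SLProgram.doubleSteps, List.foldl_append, h2]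
  split_ifs with hodd
  · rw [show 2 * (h / 2) = h - 1 by omega] at h1
    obtain ⟨c₂, h3, h4⟩ := h1.mulSteps_input he hP hQ (by omega)
    rw [show h - 1 + 1 = h by omega] at h3
    exact ⟨c₂, h3, h4⟩
  · rw [show 2 * (h / 2) = h by omega] at h1
    exact ⟨c₁, h1, rfl⟩

theorem output_initProg : (initProg e n).output (coeffsBelow Q (n + 1)) =
    starState e n Q fun k r => if k = 0 ∧ r = 0 then 1 else 0 := by
  have hrun : (initProg e n).run (coeffsBelow Q (n + 1)) = coeffsBelow Q (n + 1) ++ [1] := by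
    simp [initProg, run, Instr.eval]
  rw [output, hrun]
  simp only [initProg]
  rw [List.map_map, starState, List.range_add, List.map_append, List.map_map]
  congr 1
  · refine List.map_congr_left fun k hk => ?_
    rw [List.mem_range] at hk
    simp only [Function.comp]
    rw [min_eq_left (by omega), List.getD_append _ _ _ k (by rw [length_coeffsBelow]; omega),
      getD_coeffsBelow, if_pos hk]
  · refine List.map_congr_left fun t ht => ?_
    simp only [Function.comp]
    rcases Nat.eq_zero_or_pos t with rfl | h0
    · rw [min_eq_left (by omega), getD_append_add (length_coeffsBelow Q (n + 1))]
      simp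
    · rw [min_eq_right (by omega), show n + 2 = n + 1 + 1 by omega,
        getD_append_add (length_coeffsBelow Q (n + 1)), if_neg]
      · rfl
      · rintro ⟨h1, h2⟩
        have := Nat.div_add_mod t e
        rw [h1, h2] at this
        omega

theorem represents_init (he : 0 < e) :
    Represents K e n Q (fun k r => if k = 0 ∧ r = 0 then 1 else 0) 0 := by
  intro ζ _
  rw [twistProd, Finset.prod_range_zero]
  ext k
  rw [arrayEval, coeff_rowPoly, coeff_one]
  rcases eq_or_ne k 0 with rfl | hk
  · rw [if_pos (by omega), if_pos rfl, rowEval, Finset.sum_eq_single 0]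
    · simp
    · intro r _ hr
      simp [hr]
    · intro h
      exact absurd (Finset.mem_range.2 he) h
  · rw [if_neg hk]
    split_ifs
    · simp [rowEval, hk]
    · rfl

theorem foldl_starSteps (he : 0 < e) {P : SLProgram}
    (hP : Multiplies F P (2 * e * (e * n + 1))) (hQ : Q.natDegree ≤ n) :
    ∃ c : ℕ → ℕ → F, Represents K e n Q c e ∧
      (starSteps e n P).foldl (fun y P => P.output y) (coeffsBelow Q (n + 1)) =
        starState e n Q c := by
  rw [starSteps, List.foldl_cons, output_initProg]
  -- Before round `t` the number of factors is `e` without its last `log 2 e + 1 - t` binary digits;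
  -- it starts at `0`, the empty product.
  suffices h : ∀ t ≤ Nat.log 2 e + 1, ∃ c : ℕ → ℕ → F,
      Represents K e n Q c (e / 2 ^ (Nat.log 2 e + 1 - t)) ∧
      ((List.range t).flatMap fun t => SLProgram.doubleSteps e n P
        (e / 2 ^ (Nat.log 2 e - t))).foldl (fun y P => P.output y)
        (starState e n Q fun k r => if k = 0 ∧ r = 0 then 1 else 0) = starState e n Q c by
    obtain ⟨c, h1, h2⟩ := h _ le_rfl
    rw [Nat.sub_self, pow_zero, Nat.div_one] at h1
    exact ⟨c, h1, h2⟩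
  intro t
  induction t with
  | zero =>
    intro _
    refine ⟨_, ?_, rfl⟩
    rw [Nat.sub_zero, Nat.div_eq_of_lt (Nat.lt_pow_succ_log_self (by norm_num) e)]
    exact represents_init he
  | succ t ih =>
    intro ht
    obtain ⟨c, h1, h2⟩ := ih (by omega)
    rw [show Nat.log 2 e + 1 - t = (Nat.log 2 e - t) + 1 by omega, pow_succ,
      ← Nat.div_div_eq_div_mul] at h1
    obtain ⟨c', h3, h4⟩ := h1.doubleSteps he hP hQ (Nat.div_le_self _ _)
    refine ⟨c', ?_, ?_⟩
    · rwa [show Nat.log 2 e + 1 - (t + 1) = Nat.log 2 e - t by omega]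
    · rw [List.range_succ, List.flatMap_append, List.foldl_append, h2, List.flatMap_singleton, h4]

end Star

end SLProgram

/-! ### A factor that vanishes at the non-primitive roots of unity -/

section Annihilator

theorem primeDivisorList_nodup (e : ℕ) : (primeDivisorList e).Nodup :=
  List.nodup_range.filter _

theorem primeDivisorList_toFinset {e : ℕ} (he : 0 < e) :
    (primeDivisorList e).toFinset = e.primeFactors := by
  ext l
  simp only [primeDivisorList, List.mem_toFinset, List.mem_filter, List.mem_range,
    decide_eq_true_eq, Nat.mem_primeFactors, ← Nat.dvd_iff_mod_eq_zero]
  exact ⟨fun h => ⟨h.2.1, h.2.2, he.ne'⟩,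
    fun h => ⟨Nat.lt_succ_of_le (Nat.le_of_dvd he h.2.1), h.1, h.2.1⟩⟩

/-- For `l ∈ S` let `l ^ a` be the exact power of `l` in `e`: it divides `e / x` for every other `x`
in `S`, but not `e / l`. -/
theorem not_dvd_sum_div_primeFactors {e : ℕ} (he : 0 < e) {S : Finset ℕ}
    (hS : S ⊆ e.primeFactors) (hne : S.Nonempty) : ¬ e ∣ ∑ l ∈ S, e / l := by
  intro hdvd
  obtain ⟨l, hl⟩ := hne
  have hlp := Nat.prime_of_mem_primeFactors (hS hl)
  obtain ⟨a, m, hm, rfl⟩ := Nat.exists_eq_pow_mul_and_not_dvd he.ne' l hlp.ne_one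
  have ha : a ≠ 0 := by
    rintro rfl
    rw [pow_zero, one_mul] at hS
    exact hm (Nat.dvd_of_mem_primeFactors (hS hl))
  rw [← Finset.add_sum_erase _ _ hl] at hdvd
  have h1 : l ^ a ∣ ∑ x ∈ S.erase l, l ^ a * m / x := by
    refine Finset.dvd_sum fun x hx => ?_
    have hxS := hS (Finset.mem_of_mem_erase hx)
    have hxp := Nat.prime_of_mem_primeFactors hxS
    have hcop : Nat.Coprime x (l ^ a) :=
      Nat.Coprime.pow_right a ((Nat.coprime_primes hxp hlp).2 (Finset.ne_of_mem_erase hx))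
    have hxm : x ∣ m := hcop.dvd_of_dvd_mul_left (Nat.dvd_of_mem_primeFactors hxS)
    rw [Nat.mul_div_assoc _ hxm]
    exact Dvd.intro _ rfl
  have h2 : l ^ a ∣ l ^ a * m / l := (Nat.dvd_add_left h1).1 ((Dvd.intro _ rfl).trans hdvd)
  obtain ⟨b, hb⟩ := Nat.exists_eq_succ_of_ne_zero ha
  rw [hb, pow_succ, mul_assoc, mul_comm l m, ← mul_assoc, Nat.mul_div_cancel _ hlp.pos,
    Nat.mul_dvd_mul_iff_left (pow_pos hlp.pos b)] at h2
  exact hm h2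

variable {K : Type*} [Field K]

theorem sum_pow_pow_eq {e : ℕ} {ζ : K} (hζ : IsPrimitiveRoot ζ e) (s : ℕ) :
    ∑ j ∈ Finset.range e, (ζ ^ j) ^ s = if e ∣ s then (e : K) else 0 := by
  have h : ∀ j, (ζ ^ j) ^ s = (ζ ^ s) ^ j := fun j => by rw [← pow_mul, ← pow_mul, mul_comm]
  simp only [h]
  split_ifs with hs
  · rw [(hζ.pow_eq_one_iff_dvd s).2 hs]
    simp
  · have h1 : ζ ^ s ≠ 1 := fun h => hs ((hζ.pow_eq_one_iff_dvd s).1 h)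
    rw [geom_sum_eq h1, ← pow_mul, mul_comm, pow_mul, hζ.pow_eq_one, one_pow, sub_self, zero_div]

/-- The product of `1 - ζ ^ (e / l)` for the prime divisors `l` of `e`. -/
def annihilator (e : ℕ) (ζ : K) : K :=
  ((primeDivisorList e).map fun l => 1 - ζ ^ (e / l)).prod

/-- A non-primitive root has order dividing `e / l` for some prime `l ∣ e`. -/
theorem annihilator_eq_zero {e : ℕ} (he : 0 < e) {ζ : K} (h : ζ ^ e = 1)
    (hζ : ¬ IsPrimitiveRoot ζ e) : annihilator e ζ = 0 := by
  have h1 : ∃ l, l.Prime ∧ l ∣ e ∧ ζ ^ (e / l) = 1 := by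
    by_contra hcon
    push Not at hcon
    refine hζ ?_
    rw [← orderOf_eq_of_pow_and_pow_div_prime he h hcon]
    exact IsPrimitiveRoot.orderOf ζ
  obtain ⟨l, hl, hle, hl1⟩ := h1
  refine List.prod_eq_zero (List.mem_map.2 ⟨l, ?_, by rw [hl1, sub_self]⟩)
  rw [← List.mem_toFinset, primeDivisorList_toFinset he]
  exact Nat.mem_primeFactors.2 ⟨hl, hle, he.ne'⟩

/-- Summing over all `e`-th roots of unity extracts `e` times the constant term modulo `x ^ e - 1`.
In the expanded product only the empty subset of primes contributes to it. -/
theorem sum_annihilator {e : ℕ} (he : 0 < e) {ζ : K} (hζ : IsPrimitiveRoot ζ e) :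
    ∑ j ∈ Finset.range e, annihilator e (ζ ^ j) = e := by
  have h : ∀ ξ : K, annihilator e ξ =
      ∑ S ∈ e.primeFactors.powerset, (-1) ^ S.card * ξ ^ (∑ l ∈ S, e / l) := by
    intro ξ
    rw [annihilator, ← List.prod_toFinset _ (primeDivisorList_nodup e),
      primeDivisorList_toFinset he, Finset.prod_congr rfl fun l _ =>
        (sub_eq_add_neg 1 (ξ ^ (e / l))).trans (add_comm _ _), Finset.prod_add]
    refine Finset.sum_congr rfl fun S _ => ?_
    rw [Finset.prod_const_one, mul_one, Finset.prod_neg, Finset.prod_pow_eq_pow_sum]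
  simp only [h]
  rw [Finset.sum_comm, Finset.sum_eq_single ∅]
  · simp
  · intro S hS hne
    rw [← Finset.mul_sum, sum_pow_pow_eq hζ, if_neg, mul_zero]
    exact not_dvd_sum_div_primeFactors he (Finset.mem_powerset.1 hS)
      (Finset.nonempty_iff_ne_empty.2 hne)
  · intro h0
    exact absurd (Finset.empty_mem_powerset _) h0

theorem sum_rowEval {F : Type*} [CommRing F] [Algebra F K] {e : ℕ} (he : 0 < e) {ζ : K}
    (hζ : IsPrimitiveRoot ζ e) (b : ℕ → F) :
    ∑ j ∈ Finset.range e, rowEval e (ζ ^ j) b = e * algebraMap F K (b 0) := by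
  simp only [rowEval]
  rw [Finset.sum_comm, Finset.sum_eq_single 0]
  · simp
  · intro r hr hr0
    rw [← Finset.mul_sum, sum_pow_pow_eq hζ, if_neg, mul_zero]
    exact fun h => (Nat.le_of_dvd (Nat.pos_of_ne_zero hr0) h).not_gt (Finset.mem_range.1 hr)
  · intro h
    exact absurd (Finset.mem_range.2 he) h

end Annihilator

/-! ### Extraction of the coefficients of `q` -/

namespace SLProgram

section Extract

variable {F : Type*} [CommRing F] {e n : ℕ}

/-- The rows `b 0, …, b n` of an array. -/
def rowsState (e n : ℕ) (b : ℕ → ℕ → F) : List F :=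
  (List.range ((n + 1) * e)).map fun t => b (t / e) (t % e)

theorem getD_rowsState {b : ℕ → ℕ → F} {k r : ℕ} (hk : k < n + 1) (hr : r < e) :
    (rowsState e n b).getD (k * e + r) 0 = b k r := by
  rw [rowsState, getD_map_range, if_pos (mul_add_lt_of_lt hk hr), mul_comm k e,
    Nat.mul_add_div (by omega), Nat.div_eq_of_lt hr, add_zero, Nat.mul_add_mod,
    Nat.mod_eq_of_lt hr]

theorem output_annihilateProg (he : 0 < e) (b : ℕ → ℕ → F) (l : ℕ) :
    (annihilateProg e n l).output (rowsState e n b) =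
      rowsState e n fun k r => b k r - b k ((r + (e - e / l)) % e) := by
  rw [annihilateProg, output_parLayer _ (by simp [rowsState]), List.map_map]
  conv_rhs => rw [rowsState]
  refine List.map_congr_left fun t ht => ?_
  rw [List.mem_range] at ht
  have h1 : t / e < n + 1 := by rwa [Nat.div_lt_iff_lt_mul he]
  simp only [Function.comp, Instr.eval]
  rw [getD_rowsState h1 (Nat.mod_lt _ he)]
  conv_lhs => rw [← Nat.div_add_mod' t e]
  rw [getD_rowsState h1 (Nat.mod_lt _ he), Nat.div_add_mod']

variable {K : Type*} [Field K] [Algebra F K]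

theorem rowEval_sub_rotate (l : ℕ) {ζ : K} (hζ : ζ ^ e = 1) (b : ℕ → F) :
    rowEval e ζ (fun r => b r - b ((r + (e - e / l)) % e)) =
      (1 - ζ ^ (e / l)) * rowEval e ζ b := by
  have h : e ∣ (e - e / l) + e / l := by rw [Nat.sub_add_cancel (Nat.div_le_self _ _)]
  rw [sub_mul, one_mul, ← rowEval_rotate hζ h b, rowEval, rowEval, rowEval,
    ← Finset.sum_sub_distrib]
  exact Finset.sum_congr rfl fun r _ => by rw [map_sub, sub_mul]

theorem foldl_annihilateProg (he : 0 < e) (b : ℕ → ℕ → F) (L : List ℕ) :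
    ∃ b' : ℕ → ℕ → F, (L.map (annihilateProg e n)).foldl (fun y P => P.output y)
      (rowsState e n b) = rowsState e n b' ∧
      ∀ k, ∀ ζ : K, ζ ^ e = 1 → rowEval e ζ (b' k) =
        (L.map fun l => 1 - ζ ^ (e / l)).prod * rowEval e ζ (b k) := by
  induction L generalizing b with
  | nil => exact ⟨b, rfl, fun k ζ _ => by simp⟩
  | cons l L ih =>
    obtain ⟨b', h1, h2⟩ := ih (fun k r => b k r - b k ((r + (e - e / l)) % e))
    refine ⟨b', ?_, fun k ζ hζ => ?_⟩
    · rw [List.map_cons, List.foldl_cons, output_annihilateProg he, h1]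
    · rw [h2 k ζ hζ, rowEval_sub_rotate l hζ, List.map_cons, List.prod_cons]
      ring

theorem foldl_extractSteps (he : 0 < e) (he0 : (e : K) ≠ 0) {ζ₀ : K} (hζ₀ : IsPrimitiveRoot ζ₀ e)
    (hinj : Function.Injective (algebraMap F K)) {Q q : F[X]} {c : ℕ → ℕ → F}
    (hc : ∀ ζ : K, IsPrimitiveRoot ζ e → arrayEval e (e * n + 1) ζ c =
      (q.comp (X ^ e)).map (algebraMap F K)) :
    (extractSteps e n).foldl (fun y P => P.output y) (starState e n Q c) =
      coeffsBelow q (n + 1) := by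
  have hsel : output ([], (List.range ((n + 1) * e)).map fun t => n + 1 + (t / e * e * e + t % e))
      (starState e n Q c) = rowsState e n fun k r => c (k * e) r := by
    rw [output_select, List.map_map, rowsState]
    refine List.map_congr_left fun t ht => ?_
    rw [List.mem_range] at ht
    have h1 : t / e < n + 1 := by rwa [Nat.div_lt_iff_lt_mul he]
    refine getD_starState_right ?_ (Nat.mod_lt _ he)
    rw [mul_comm e n]
    exact Nat.lt_succ_of_le (Nat.mul_le_mul_right _ (by omega))
  obtain ⟨b, h1, h2⟩ := foldl_annihilateProg (K := K) (n := n) he (fun k r => c (k * e) r)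
    (primeDivisorList e)
  rw [extractSteps, List.foldl_cons, hsel, List.foldl_append, h1, List.foldl_cons, List.foldl_nil,
    output_select, List.map_map, coeffsBelow]
  refine List.map_congr_left fun k hk => ?_
  rw [List.mem_range] at hk
  have h3 : (rowsState e n b).getD (k * e) 0 = b k 0 := getD_rowsState (r := 0) hk he
  simp only [Function.comp]
  rw [h3]
  -- At primitive roots the row takes the value `q.coeff k`; at the others the annihilator is zero,
  -- so the row's value there does not matter.
  have h4 : ∀ ζ : K, ζ ^ e = 1 → rowEval e ζ (b k) =
      annihilator e ζ * algebraMap F K (q.coeff k) := by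
    intro ζ hζ
    rw [h2 k ζ hζ]
    change annihilator e ζ * _ = _
    by_cases hprim : IsPrimitiveRoot ζ e
    · congr 1
      have h5 := congrArg (fun f => f.coeff (k * e)) (hc ζ hprim)
      simp only [arrayEval, coeff_rowPoly] at h5
      rw [if_pos, coeff_map, ← expand_eq_comp_X_pow, coeff_expand_mul he] at h5
      · exact h5
      · rw [mul_comm e n]
        exact Nat.lt_succ_of_le (Nat.mul_le_mul_right _ (by omega))
    · rw [annihilator_eq_zero he hζ hprim, zero_mul, zero_mul]
  -- Averaging over all `e`-th roots of unity compares the constant terms of both sides.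
  refine hinj (mul_left_cancel₀ he0 ?_)
  rw [← sum_rowEval he hζ₀, ← sum_annihilator he hζ₀, Finset.sum_mul]
  refine Finset.sum_congr rfl fun j _ => h4 _ ?_
  rw [← pow_mul, mul_comm, pow_mul, hζ₀.pow_eq_one, one_pow]

end Extract

end SLProgram

namespace SLProgram

/-! ### The number of operations -/

/-- The number of operations of a list of programs, with the copying of the outputs. -/
def listCost (l : List SLProgram) : ℕ := (l.map fun P => P.cost + P.2.length).sum

theorem listCost_append (l₁ l₂ : List SLProgram) :
    listCost (l₁ ++ l₂) = listCost l₁ + listCost l₂ := by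
  simp [listCost]

theorem listCost_cons (P : SLProgram) (l : List SLProgram) :
    listCost (P :: l) = P.cost + P.2.length + listCost l := by
  simp [listCost]

theorem listCost_nil : listCost [] = 0 := rfl

theorem listCost_flatMap_le {α : Type*} (l : List α) (f : α → List SLProgram) (B : ℕ)
    (h : ∀ x ∈ l, listCost (f x) ≤ B) : listCost (l.flatMap f) ≤ l.length * B := by
  induction l with
  | nil => simp [listCost]
  | cons x l ih =>
    rw [List.flatMap_cons, listCost_append, List.length_cons, add_mul, one_mul, add_comm]
    exact Nat.add_le_add (ih fun y hy => h y (List.mem_cons_of_mem _ hy)) (h x List.mem_cons_self)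

theorem listCost_map_le {α : Type*} (l : List α) (f : α → SLProgram) (B : ℕ)
    (h : ∀ x ∈ l, (f x).cost + (f x).2.length ≤ B) : listCost (l.map f) ≤ l.length * B := by
  induction l with
  | nil => simp [listCost]
  | cons x l ih =>
    rw [List.map_cons, listCost_cons, List.length_cons, add_mul, one_mul, add_comm]
    exact Nat.add_le_add (ih fun y hy => h y (List.mem_cons_of_mem _ hy)) (h x List.mem_cons_self)

theorem cost_select (l : List ℕ) : cost ([], l) = 0 := rfl

theorem listCost_mulSteps (e n : ℕ) (P : SLProgram) (pos : ℕ → ℕ → ℕ) :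
    listCost (mulSteps e n P pos) =
      P.cost + P.2.length + 4 * (n + 1) + 2 * (2 * e * (e * n + 1)) + 2 * ((e * n + 1) * e) := by
  simp only [mulSteps, listCost_cons, listCost_nil, cost_keep, length_keep, foldProg,
    cost_parLayer, length_parLayer, packProg, cost_select, List.length_append, List.length_map,
    List.length_range]
  ring

/-- The number of outputs enters the cost of copying; it is visible from the product of two zero
polynomials. -/
theorem Multiplies.length_eq {F : Type*} [CommRing F] {P : SLProgram} {N : ℕ}
    (h : Multiplies F P N) : P.2.length = 2 * N - 1 := by
  have h0 := congrArg List.length (h 0 0 (by simp) (by simp))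
  rwa [length_output, length_coeffsBelow] at h0

theorem listCost_starSteps_le (e n : ℕ) (P : SLProgram) (B : ℕ)
    (hB : ∀ pos, listCost (mulSteps e n P pos) ≤ B) :
    listCost (starSteps e n P) ≤
      1 + (n + 1 + (e * n + 1) * e) + (Nat.log 2 e + 1) * (2 * B) := by
  rw [starSteps, listCost_cons]
  refine Nat.add_le_add (by simp [initProg, cost]) ?_
  refine (listCost_flatMap_le _ _ (2 * B) fun t _ => ?_).trans (by rw [List.length_range])
  rw [doubleSteps, listCost_append]
  have h1 := hB (twistPos e n (e / 2 ^ (Nat.log 2 e - t) / 2))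
  have h2 := hB (inputPos e n (e / 2 ^ (Nat.log 2 e - t) - 1))
  split_ifs
  · omega
  · rw [listCost_nil]; omega

theorem listCost_extractSteps_le (e n : ℕ) :
    listCost (extractSteps e n) ≤
      (n + 1) * e + (e + 1) * (2 * ((n + 1) * e)) + (n + 1) := by
  rw [extractSteps, listCost_cons, listCost_append, ← add_assoc]
  refine Nat.add_le_add (Nat.add_le_add (by simp [cost]) ?_) (by simp [listCost, cost])
  refine (listCost_map_le _ _ (2 * ((n + 1) * e)) fun l _ => ?_).trans
    (Nat.mul_le_mul_right _ ?_)
  · rw [annihilateProg, cost_parLayer, length_parLayer]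
    simp
    omega
  -- The crude bound `e + 1` for the number of prime divisors is enough, as `e ^ 2 n` is of order `p
  -- ^ (i + 2) d`.
  · exact (List.length_filter_le _ _).trans (by simp)

theorem listCost_substSteps_le (p n : ℕ) :
    listCost (substSteps p n) ≤
      (p * n + 1) + (Nat.log p n + 1) * ((p - 1) * (2 * (p * n + 1))) := by
  rw [substSteps, listCost_cons]
  refine Nat.add_le_add (by simp [cost]) ?_
  refine (listCost_flatMap_le _ _ ((p - 1) * (2 * (p * n + 1))) fun k _ => ?_).trans
    (by rw [List.length_range])
  refine (listCost_map_le _ _ (2 * (p * n + 1)) fun s _ => ?_).trans (by rw [List.length_range])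
  rw [substProg, cost_parLayer, length_parLayer]
  simp
  omega

theorem cost_towerProg_le {p : ℕ} (hp : 2 ≤ p) {d : ℕ} (hd : 0 < d) (i : ℕ) {P : SLProgram} {m : ℕ}
    (hcost : P.cost ≤ 144 * m) (hlen : P.2.length = 2 * mulSize p d i - 1)
    (hm : p ^ (i + 2) * d ≤ m) :
    (towerProg p d i P).cost ≤
      4 * (p ^ (i + 2) * d * Nat.log p (p ^ i * d)) + 2000 * (m * Nat.log 2 p) := by
  have hn : 0 < p ^ i * d := Nat.mul_pos (pow_pos (by omega) i) hd
  rw [mulSize] at hlen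
  rw [show p ^ (i + 2) * d = p ^ 2 * (p ^ i * d) by ring] at hm ⊢
  rw [towerProg]
  generalize p ^ i * d = n at *
  obtain ⟨e, he⟩ : ∃ e, e = 2 * p - 1 := ⟨_, rfl⟩
  rw [← he] at hlen ⊢
  have he2 : e + 1 = 2 * p := by omega
  have hlog : 1 ≤ Nat.log 2 p := Nat.log_pos (by norm_num) hp
  -- `log 2 e + 1 ≤ log 2 p + 2`, and `log 2 p ≥ 1`.
  have hlog2 : Nat.log 2 e + 1 ≤ 3 * Nat.log 2 p := by
    have h1 : Nat.log 2 e ≤ Nat.log 2 (p * 2) := Nat.log_mono_right (by omega)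
    rw [Nat.log_mul_base (by norm_num) (by omega)] at h1
    omega
  set N := p ^ 2 * n with hN
  have hpn : 2 * (p * n) ≤ N := by rw [hN]; nlinarith
  have hnp : 2 * n ≤ p * n := Nat.mul_le_mul_right _ hp
  have heD : (e * n + 1) * e ≤ 6 * N := by
    have h1 : e ≤ 2 * p := by omega
    have h2 : (e * n + 1) * e ≤ (2 * p * n + 1) * (2 * p) := by gcongr
    have h3 : (2 * p * n + 1) * (2 * p) = 4 * N + 2 * p := by rw [hN]; ring
    have h4 : p * 1 ≤ p * n := Nat.mul_le_mul_left _ hn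
    omega
  -- The multiplication itself costs at most `144 m`; copying, packing and folding are linear in `N
  -- ≤ m`.
  have hmul : ∀ pos, listCost (mulSteps e n P pos) ≤ 208 * m := by
    intro pos
    rw [listCost_mulSteps, hlen, show 2 * e * (e * n + 1) = 2 * ((e * n + 1) * e) by ring]
    omega
  have hstar := listCost_starSteps_le e n P _ hmul
  have hstar2 : (Nat.log 2 e + 1) * (2 * (208 * m)) ≤ 1248 * (m * Nat.log 2 p) := by
    calc _ ≤ 3 * Nat.log 2 p * (2 * (208 * m)) := Nat.mul_le_mul_right _ hlog2
      _ = _ := by ring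
  have hext := listCost_extractSteps_le e n
  have hext2 : (n + 1) * e + (e + 1) * (2 * ((n + 1) * e)) ≤ 20 * N := by
    have h1 : e ≤ 2 * p := by omega
    have h2 : n + 1 ≤ 2 * n := by omega
    calc (n + 1) * e + (e + 1) * (2 * ((n + 1) * e))
        ≤ (2 * n) * (2 * p) + (2 * p) * (2 * ((2 * n) * (2 * p))) := by gcongr; omega
      _ = 4 * (p * n) + 16 * N := by rw [hN]; ring
      _ ≤ 20 * N := by omega
  have hsub := listCost_substSteps_le p n
  have hsub2 : (Nat.log p n + 1) * ((p - 1) * (2 * (p * n + 1))) ≤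
      4 * (N * Nat.log p n) + 4 * N := by
    calc _ ≤ (Nat.log p n + 1) * (p * (2 * (2 * (p * n)))) := by gcongr <;> omega
      _ = _ := by rw [hN]; ring
  have hmm : m ≤ m * Nat.log 2 p := Nat.le_mul_of_pos_right _ hlog
  refine (cost_seq_le _ _).trans ?_
  change n + 1 + listCost _ ≤ _
  rw [listCost_append]
  split_ifs
  · rw [listCost_nil]
    omega
  · rw [listCost_append]
    omega

/-- Without instructions each output is an input or `0`, which cannot be the product of two variable
constants. -/
theorem one_le_time {mulAlg : ℕ × ℕ → SLProgram} {M : ℕ → ℕ → ℕ}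
    (h : IsMultiplicationAlgorithm mulAlg M) {p : ℕ} (hp : p.Prime) : 1 ≤ M p 1 := by
  have := Fact.mk hp
  obtain ⟨hc, hmul⟩ := h.2 p 1 hp one_pos
  refine le_trans ?_ hc
  by_contra hlt
  have hnil : (mulAlg (p, 1)).1 = [] := List.length_eq_zero_iff.1 (by rw [cost] at hlt; omega)
  have hout : ∀ a b : ZMod p, (mulAlg (p, 1)).2.map (fun k => [a, b].getD k 0) = [a * b] := by
    intro a b
    have h1 := hmul (C a) (C b) (degree_C_le.trans_lt (by norm_num))
      (degree_C_le.trans_lt (by norm_num))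
    rw [output, run, hnil] at h1
    simpa [coeffsBelow] using h1
  have hlen := congrArg List.length (hout 0 0)
  rw [List.length_map] at hlen
  obtain ⟨k, hk⟩ := List.length_eq_one_iff.1 (hlen.trans rfl)
  simp only [hk, List.map_cons, List.map_nil, List.cons.injEq, and_true] at hout
  have h11 := hout 1 1
  have h10 := hout 1 0
  have h01 := hout 0 1
  rcases k with _ | _ | k
  · simp at h10
  · simp at h01
  · simp at h11

theorem le_time {mulAlg : ℕ × ℕ → SLProgram} {M : ℕ → ℕ → ℕ}
    (h : IsMultiplicationAlgorithm mulAlg M) {p : ℕ} (hp : p.Prime) (hM : IsRegularTime (M p))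
    {n : ℕ} (hn : 0 < n) : n ≤ M p n := by
  have h1 := hM.1 1 n one_pos hn
  have h2 := Nat.mul_le_mul_right n (one_le_time h hp)
  omega

theorem time_le_of_le_mul {M : ℕ → ℕ} (hM : IsRegularTime M) {k n l : ℕ} (hk : 0 < k) (hn : 0 < n)
    (hl : 0 < l) (h : l ≤ k * n) : M l ≤ k ^ 2 * M n := by
  refine le_trans ?_ (hM.2 k n hk hn)
  have h1 := hM.1 l (k * n) hl h
  exact Nat.le_of_mul_le_mul_right (h1.trans (Nat.mul_le_mul_left _ h)) (Nat.mul_pos hk hn)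

/-- The factor `12` costs `12 ^ 2 = 144` in the multiplication time, by `time_le_of_le_mul`. -/
theorem mulSize_le {p : ℕ} (hp : 2 ≤ p) {d : ℕ} (hd : 0 < d) (i : ℕ) :
    mulSize p d i ≤ 12 * (p ^ (i + 2) * d) := by
  have hn : 0 < p ^ i * d := Nat.mul_pos (pow_pos (by omega) i) hd
  rw [mulSize, show p ^ (i + 2) * d = p ^ 2 * (p ^ i * d) by ring]
  generalize p ^ i * d = n at *
  have h1 : 2 * p - 1 ≤ 2 * p := by omega
  calc 2 * (2 * p - 1) * ((2 * p - 1) * n + 1) ≤ 2 * (2 * p) * (2 * p * n + 1) := by gcongr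
    _ = 8 * (p ^ 2 * n) + 4 * (p * 1) := by ring
    _ ≤ 8 * (p ^ 2 * n) + 4 * (p * (p * n)) := by
      gcongr
      exact Nat.mul_pos (by omega) hn
    _ = 12 * (p ^ 2 * n) := by ring

theorem mulSize_pos {p : ℕ} (hp : 2 ≤ p) (d i : ℕ) : 0 < mulSize p d i :=
  Nat.mul_pos (Nat.mul_pos two_pos (by omega)) (Nat.succ_pos _)

end SLProgram

/-! ### Correctness of the whole algorithm and the theorem -/

namespace SLProgram

theorem output_towerProg {p d i : ℕ} [Fact p.Prime] {P : SLProgram}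
    (hP : Multiplies (ZMod p) P (mulSize p d i)) {Q q : (ZMod p)[X]}
    {K : Type*} [Field K] [IsAlgClosed K] [CharP K p] [Algebra (ZMod p) K]
    (hQ : Q.natDegree = p ^ i * d) (hq : q.natDegree = p ^ i * d)
    (hlin : IsLinearStep p d i → q = Q)
    (hstar : ¬ IsLinearStep p d i → ∀ ζ : K, IsPrimitiveRoot ζ (2 * p - 1) →
      twistProd Q ζ (2 * p - 1) = (q.comp (X ^ (2 * p - 1))).map (algebraMap (ZMod p) K)) :
    (towerProg p d i P).output (allCoeffs Q) = allCoeffs (q.comp (X ^ p - X)) := by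
  have hp := (Fact.out : p.Prime)
  have hp2 := hp.two_le
  have hcomp : (q.comp (X ^ p - X)).natDegree = p * (p ^ i * d) := by
    rw [natDegree_comp, FiniteField.X_pow_card_sub_X_natDegree_eq _ hp.one_lt, hq, mul_comm]
  have hiff : (i = 0 ∨ (p = 2 ∧ d % 2 = 1 ∧ i = 1)) ↔ IsLinearStep p d i := by
    rw [IsLinearStep, Nat.odd_iff]
  rw [allCoeffs, allCoeffs, hQ, hcomp, towerProg, output_seq _ (length_coeffsBelow _ _),
    List.foldl_append]
  by_cases h : IsLinearStep p d i
  · rw [if_pos (hiff.2 h), List.foldl_nil, ← hlin h]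
    exact foldl_substSteps hq.le
  · have hQn := hQ.le
    have : NeZero ((2 * p - 1 : ℕ) : K) := ⟨two_mul_sub_one_cast_ne_zero (p := p) _⟩
    obtain ⟨ζ₀, hζ₀⟩ := exists_isPrimitiveRoot K (2 * p - 1)
    obtain ⟨c, h1, h2⟩ := foldl_starSteps (K := K) (e := 2 * p - 1) (by omega) hP hQn
    rw [if_neg (fun h' => h (hiff.1 h')), List.foldl_append, h2,
      foldl_extractSteps (K := K) (by omega) (NeZero.ne _) hζ₀ (algebraMap (ZMod p) K).injective
        (q := q) fun ζ hζ => (h1 ζ hζ.pow_eq_one).trans (hstar h ζ hζ)]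
    exact foldl_substSteps hq.le

end SLProgram

theorem mainTheorem10 :
    ∃ C : ℝ, ∀ (mulAlg : ℕ × ℕ → SLProgram) (M : ℕ → ℕ → ℕ),
      IsMultiplicationAlgorithm mulAlg M →
      (∀ p : ℕ, p.Prime → IsRegularTime (M p)) →
      ∃ alg : ℕ × ℕ × ℕ → SLProgram, Computable alg ∧
        ∀ (p : ℕ), p.Prime → ∀ (d : ℕ) (Q₀ : (ZMod p)[X]),
          Irreducible Q₀ → Q₀.natDegree = d →
          Algebra.trace (ZMod p) (AdjoinRoot Q₀) (AdjoinRoot.root Q₀) ≠ 0 →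
          ∀ i : ℕ,
            ((alg (p, d, i)).cost : ℝ) ≤
                C * ((p : ℝ) ^ (i + 2) * d * Real.logb p ((p : ℝ) ^ i * d)
                  + (M p (p ^ (i + 2) * d) : ℝ) * Real.log p) ∧
              (alg (p, d, i)).output (allCoeffs (towerMinpoly p Q₀ i)) =
                allCoeffs (towerMinpoly p Q₀ (i + 1)) ∧
              (IsLinearStep p d i →
                towerMinpoly p Q₀ (i + 1) = (towerMinpoly p Q₀ i).comp (X ^ p - X)) ∧
              (¬ IsLinearStep p d i →
                ∃ q : (ZMod p)[X],
                  starPoly p (towerMinpoly p Q₀ i) =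
                      (q.comp (X ^ (2 * p - 1))).map (algebraMap (ZMod p) (CycloRing p)) ∧
                    towerMinpoly p Q₀ (i + 1) = q.comp (X ^ p - X)) := by
  -- The constant is the `2000` of `cost_towerProg_le`, doubled in passing from `Nat.log 2 p` to
  -- `Real.log p`.
  refine ⟨4000, fun mulAlg M hM hreg => ⟨_, SLProgram.computable_towerProg hM.1, ?_⟩⟩
  intro p hp d Q₀ hQ hd htr i
  have := Fact.mk hp
  have hp2 := hp.two_le
  have hd0 : 0 < d := hd ▸ hQ.natDegree_pos
  have hN : 0 < p ^ (i + 2) * d := Nat.mul_pos (pow_pos hp.pos _) hd0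
  have hn0 : p ^ i * d ≠ 0 := (Nat.mul_pos (pow_pos hp.pos _) hd0).ne'
  obtain ⟨hcost, hmul⟩ := hM.2 p (SLProgram.mulSize p d i) hp (SLProgram.mulSize_pos hp2 d i)
  have hmul' : SLProgram.Multiplies (ZMod p) (mulAlg (p, SLProgram.mulSize p d i))
    (SLProgram.mulSize p d i) := hmul
  obtain ⟨a, ha⟩ := exists_isTowerSeq hQ
  have hmin := ha.towerMinpoly_eq hQ htr
  obtain ⟨horb, horb', -⟩ := ha.orbit hQ htr i
  have hsucc := ha.minpoly_succ hQ htr i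
  rw [hd] at horb horb' hsucc
  have hlin : IsLinearStep p d i →
      minpoly (ZMod p) (a i ^ stepExponent p d i) = minpoly (ZMod p) (a i) := by
    intro h
    rw [stepExponent, if_pos h, pow_one]
  have hstar : ¬ IsLinearStep p d i → ∀ ζ : AlgebraicClosure (ZMod p),
      IsPrimitiveRoot ζ (2 * p - 1) →
      twistProd (minpoly (ZMod p) (a i)) ζ (2 * p - 1) =
        ((minpoly (ZMod p) (a i ^ stepExponent p d i)).comp (X ^ (2 * p - 1))).map
          (algebraMap (ZMod p) (AlgebraicClosure (ZMod p))) := by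
    intro h ζ hζ
    have hse : stepExponent p d i = 2 * p - 1 := by rw [stepExponent, if_neg h]
    rw [hse] at horb' ⊢
    exact twistProd_minpoly horb horb' hn0 ⟨p - 1, by omega⟩ hζ
  refine ⟨?_, ?_, fun h => ?_, fun h => ?_⟩
  · have h1 := SLProgram.cost_towerProg_le hp2 hd0 i (m := M p (p ^ (i + 2) * d))
      (hcost.trans (SLProgram.time_le_of_le_mul (hreg p hp) (by norm_num) hN
        (SLProgram.mulSize_pos hp2 d i) (SLProgram.mulSize_le hp2 hd0 i)))
      hmul'.length_eq (SLProgram.le_time hM hp (hreg p hp) hN)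
    have h2 : (Nat.log p (p ^ i * d) : ℝ) ≤ Real.logb p ((p : ℝ) ^ i * d) := by
      have := Real.natLog_le_logb (p ^ i * d) p
      push_cast at this
      exact this
    have h3 : (Nat.log 2 p : ℝ) ≤ 2 * Real.log p := by
      have h4 := Real.natLog_le_logb p 2
      have h5 : (0.5 : ℝ) ≤ Real.log 2 := by linarith [Real.log_two_gt_d9]
      have h6 : 0 ≤ Real.log p := Real.log_natCast_nonneg p
      refine h4.trans ?_
      rw [Real.logb, Nat.cast_ofNat, div_le_iff₀ (by linarith)]
      nlinarith
    have h4 : 0 ≤ Real.logb p ((p : ℝ) ^ i * d) := (Nat.cast_nonneg _).trans h2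
    calc _ ≤ ((4 * (p ^ (i + 2) * d * Nat.log p (p ^ i * d)) +
          2000 * (M p (p ^ (i + 2) * d) * Nat.log 2 p) : ℕ) : ℝ) := by exact_mod_cast h1
      _ = 4 * ((p : ℝ) ^ (i + 2) * d * Nat.log p (p ^ i * d)) +
          2000 * (M p (p ^ (i + 2) * d) * Nat.log 2 p) := by push_cast; ring
      _ ≤ 4000 * ((p : ℝ) ^ (i + 2) * d * Real.logb p ((p : ℝ) ^ i * d)) +
          2000 * (M p (p ^ (i + 2) * d) * (2 * Real.log p)) := by
        gcongr
        norm_num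
      _ = _ := by ring
  · rw [hmin, hmin, hsucc]
    refine SLProgram.output_towerProg (K := AlgebraicClosure (ZMod p)) hmul'
      (natDegree_minpoly_eq_minimalPeriod horb hn0)
      (natDegree_minpoly_eq_minimalPeriod horb' hn0) hlin hstar
  · rw [hmin, hmin, hsucc, hlin h]
  · rw [hmin, hmin, hsucc]
    exact ⟨_, starPoly_eq (K := AlgebraicClosure (ZMod p)) (hstar h), rfl⟩
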